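/- Let $R$ be a commutative ring with identity and let $A=\begin{bmatrix}a&b\\c&d\end{bmatrix}$ be a $2\times 2$ matrix over $R$ that is unimodular, i.e. there is an $R$-linear map $L:\mathbb M_2(R)\to R$ with $L(A)=1$ (equivalently, $a,b,c,d$ generate the unit ideal). Let $P=\{(x,y,z,w)\in R^4\mid ax+by+cz+dw=0\}$, which is a projective $R$-module of rank $3$, and consider the $R$-algebras $$\mathcal U=R[X,Y,Z,W]/(1-aX-bY-cZ-dW),$$ $$\mathcal E=R[X,Y,Z,W,V]/\bigl(1-aXW-bXZ-cYW-dYZ-(ad-bc)V\bigr),$$ $$\mathcal X=R[X,Y,Z,W]/(1-aXW-bXZ-cYW-dYZ),$$ $$\mathcal D=R[X,Y,Z,W]/(1-aX-bY-cZ-dW,\;XW-YZ),$$ $$\mathcal W=R[X,Y,Z,W]/\bigl(1-aX-bY-cZ-dW+(ad-bc)(XW-YZ)\bigr).$$ Let $\rho:\mathcal D\to\mathcal X$ be the $R$-algebra homomorphism that maps $\bar X,\bar Y,\bar Z,\bar W$ to $\bar X\bar W,\bar X\bar Z,\bar Y\bar W,\bar Y\bar Z$ (respectively), and let $\chi:\mathcal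 X\to\mathcal D[T,T^{-1}]\otimes_{\mathcal D,\rho}\mathcal X$ be the $\mathcal D$-algebra homomorphism that maps $\bar X,\bar Y,\bar Z,\bar W$ to $T\otimes\bar X$, $T\otimes\bar Y$, $T^{-1}\otimes\bar Z$, $T^{-1}\otimes\bar W$ (respectively). For $f\in R$, a subscript $f$ denotes localization at the powers of $f$. For a commutative ring $B$, $\mathbb G_{m,B}$ is the group scheme over $\operatorname{Spec}B$ defined by the Hopf algebra $B[T,T^{-1}]$ with comultiplication $T\mapsto T\otimes T$. A scheme $Y$ over $\operatorname{Spec}B$ with a $\mathbb G_{m,B}$-action is a $\operatorname{Spec}B$-torsor under $\mathbb G_{m,B}$ (in the Zariski topology) if there are $f_1,\dots,f_n\in B$ generating the unit ideal such that, for each $i$, the base change of $Y$ to $\operatorname{Spec}B_{f_i}$ with its induced action is isomorphic over $\operatorname{Spec}B_{f_i}$ to $\mathbb G_{m,B_{f_i}}$ acting on itself by multiplication. Then the following hold. (1) For each $f\in\{a,b,c,d\}$ the $R_f$-algebra $\mathcal U_f$ is isomorphic to a polynomial $R_f$-algebra in $3$ variables. In particular, the $R$-algebra $\mathcal U$ is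 smooth of relative dimension $3$. (2) The $R$-algebra $\mathcal U$ is isomorphic to the symmetric $R$-algebra of $P$. (3) The $R$-algebra $\mathcal D$ is smooth of relative dimension $2$. (4) The $R$-algebra $\mathcal E$ is smooth of relative dimension $4$. (5) The localization of $\mathcal W$ with respect to the element $1-(ad-bc)(\bar X\bar W-\bar Y\bar Z)$ is a smooth $R$-algebra of relative dimension $3$. In particular, if $ad-bc$ is nilpotent, then the $R$-algebra $\mathcal W$ is smooth of relative dimension $3$. (6) The morphism $\operatorname{Spec}\chi:\mathbb G_{m,\mathcal D}\times_{\operatorname{Spec}\mathcal D}\operatorname{Spec}\mathcal X\to\operatorname{Spec}\mathcal X$ of schemes over $\operatorname{Spec}\mathcal D$ is a $\mathbb G_{m,\mathcal D}$-action on $\operatorname{Spec}\rho:\operatorname{Spec}\mathcal X\to\operatorname{Spec}\mathcal D$. (7) With this action, $\operatorname{Spec}\rho$ is a $\operatorname{Spec}\mathcal D$-torsor under $\mathbb G_{m,\mathcal D}$. In particular, the morphism $\operatorname{Spec}\rho$ is smooth of relative dimension $1$ and the $R$-algebra $\mathcal X$ is smooth of relative dimension $3$. (8) Assume $\det(A)=0$.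 Then for each $f\in\{a,b,c,d\}$ the $R_f$-algebra $\mathcal D_f$ is isomorphic to a polynomial $R_f$-algebra in $2$ variables. Moreover, there exists a projective $R$-module $Q$ of rank $2$ that is self-dual (i.e. isomorphic to its dual $\operatorname{Hom}_R(Q,R)$), such that the $R$-algebra $\mathcal D$ is isomorphic to the symmetric $R$-algebra of $Q$ and $Q\oplus R\cong P$ (thus $Q\oplus R^2\cong R^4$). -/

import Mathlib

open CategoryTheory CategoryTheory.MonoidalCategory CategoryTheory.Limits AlgebraicGeometry
open scoped TensorProduct LaurentPolynomial MonObj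

universe u

noncomputable section

namespace MatrixExt

/-- An element `v` of a (free) `R`-module `F` is unimodular if some `R`-linear form `L : F → R`
has `L v = 1`. -/
def IsUnimodular (R : Type u) [CommRing R] {F : Type u} [AddCommGroup F] [Module R F] (v : F) :
    Prop :=
  ∃ L : F →ₗ[R] R, L v = 1

/-- The morphism `Spec S → Spec R` of an `R`-algebra `S` is smooth of relative dimension `n`. -/
def IsSmoothOfRelDim (n : ℕ) (R S : Type u) [CommRing R] [CommRing S] [Algebra R S] : Prop :=
  SmoothOfRelativeDimension n (Spec.map (CommRingCat.ofHom (algebraMap R S)))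

/-- The localization `S_f` of an `R`-algebra `S` with respect to the powers of `f : R`;
it is an algebra over `R_f = Localization.Away f`. -/
abbrev LocAway {R : Type u} [CommRing R] (f : R) (S : Type u) [CommRing S] [Algebra R S] :
    Type u :=
  Localization (Algebra.algebraMapSubmonoid S (Submonoid.powers f))

/-- `M` is a projective `R`-module of (constant, finite) rank `n`. -/
structure IsProjectiveOfRank (n : ℕ) (R M : Type u) [CommRing R] [AddCommGroup M] [Module R M] :
    Prop where
  finite : Module.Finite R M
  projective : Module.Projective R M
  rank_eq : ∀ p : PrimeSpectrum R, Module.rankAtStalk M p = n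

section QuotAlg

/-- The `R`-algebra `R[X_0, …, X_{n-1}]/(s)` for a set `s` of polynomials. -/
def QuotAlg {R : Type u} [CommRing R] {n : ℕ} (s : Set (MvPolynomial (Fin n) R)) : Type u :=
  MvPolynomial (Fin n) R ⧸ Ideal.span s

variable {R : Type u} [CommRing R] {n : ℕ} (s : Set (MvPolynomial (Fin n) R))

instance : CommRing (QuotAlg s) := inferInstanceAs (CommRing (MvPolynomial (Fin n) R ⧸ Ideal.span s))

instance : Algebra R (QuotAlg s) :=
  inferInstanceAs (Algebra R (MvPolynomial (Fin n) R ⧸ Ideal.span s))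

/-- The quotient homomorphism. -/
def QuotAlg.mk : MvPolynomial (Fin n) R →ₐ[R] QuotAlg s := Ideal.Quotient.mkₐ R (Ideal.span s)

lemma QuotAlg.mk_eq_zero {p : MvPolynomial (Fin n) R} (hp : p ∈ s) : QuotAlg.mk s p = 0 :=
  Ideal.Quotient.eq_zero_iff_mem.2 (Ideal.subset_span hp)

/-- The `R`-algebra homomorphism `R[X_0, …, X_{n-1}]/(s) → S` that maps `X_i` to `v i`, where the
polynomials in `s` vanish at `v`. -/
def QuotAlg.lift {S : Type u} [CommRing S] [Algebra R S] (v : Fin n → S)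
    (hv : ∀ p ∈ s, MvPolynomial.aeval v p = 0) : QuotAlg s →ₐ[R] S :=
  Ideal.Quotient.liftₐ (Ideal.span s) (MvPolynomial.aeval v) fun p hp => by
    have h : Ideal.span s ≤ RingHom.ker (MvPolynomial.aeval (R := R) v) :=
      Ideal.span_le.2 fun q hq => hv q hq
    exact h hp

lemma QuotAlg.lift_mk {S : Type u} [CommRing S] [Algebra R S] (v : Fin n → S)
    (hv : ∀ p ∈ s, MvPolynomial.aeval v p = 0) (p : MvPolynomial (Fin n) R) :
    QuotAlg.lift s v hv (QuotAlg.mk s p) = MvPolynomial.aeval v p := rfl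

lemma QuotAlg.hom_ext {S : Type u} [CommRing S] {f g : QuotAlg s →+* S}
    (hC : ∀ r, f (algebraMap R _ r) = g (algebraMap R _ r))
    (hX : ∀ i, f (QuotAlg.mk s (MvPolynomial.X i)) = g (QuotAlg.mk s (MvPolynomial.X i))) :
    f = g := by
  apply Ideal.Quotient.ringHom_ext
  exact MvPolynomial.ringHom_ext hC hX

end QuotAlg

section Algebras

variable {R : Type u} [CommRing R] (A : Matrix (Fin 2) (Fin 2) R)

/-- `Λ_A (x, y, z, w) = a x + b y + c z + d w` for `A = [a, b; c, d]`. -/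
def Lam : (Fin 4 → R) →ₗ[R] R where
  toFun v := A 0 0 * v 0 + A 0 1 * v 1 + A 1 0 * v 2 + A 1 1 * v 3
  map_add' v w := by simp only [Pi.add_apply]; ring
  map_smul' r v := by simp only [Pi.smul_apply, smul_eq_mul, RingHom.id_apply]; ring

/-- The module `P_A = ker Λ_A`. -/
abbrev modP : Submodule R (Fin 4 → R) := LinearMap.ker (Lam A)

open MvPolynomial

/-- `1 - aX - bY - cZ - dW`, where `X, Y, Z, W` are the variables `X 0, X 1, X 2, X 3`. -/
def polyU : MvPolynomial (Fin 4) R :=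
  1 - C (A 0 0) * X 0 - C (A 0 1) * X 1 - C (A 1 0) * X 2 - C (A 1 1) * X 3

/-- `XW - YZ`. -/
def polyQ (R : Type u) [CommRing R] : MvPolynomial (Fin 4) R := X 0 * X 3 - X 1 * X 2

/-- `1 - aXW - bXZ - cYW - dYZ`. -/
def polyX : MvPolynomial (Fin 4) R :=
  1 - C (A 0 0) * X 0 * X 3 - C (A 0 1) * X 0 * X 2 - C (A 1 0) * X 1 * X 3
    - C (A 1 1) * X 1 * X 2

/-- `1 - aXW - bXZ - cYW - dYZ - (ad - bc)V`, where `V` is the fifth variable `X 4`. -/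
def polyE : MvPolynomial (Fin 5) R :=
  1 - C (A 0 0) * X 0 * X 3 - C (A 0 1) * X 0 * X 2 - C (A 1 0) * X 1 * X 3
    - C (A 1 1) * X 1 * X 2 - C (A 0 0 * A 1 1 - A 0 1 * A 1 0) * X 4

/-- `Φ_A = 1 - aX - bY - cZ - dW + (ad - bc)(XW - YZ)`. -/
def polyW : MvPolynomial (Fin 4) R :=
  1 - C (A 0 0) * X 0 - C (A 0 1) * X 1 - C (A 1 0) * X 2 - C (A 1 1) * X 3
    + C (A 0 0 * A 1 1 - A 0 1 * A 1 0) * (X 0 * X 3 - X 1 * X 2)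

/-- `𝓤 = R[X,Y,Z,W]/(1 - aX - bY - cZ - dW)`. -/
abbrev AlgU : Type u := QuotAlg {polyU A}

/-- `𝓔 = R[X,Y,Z,W,V]/(1 - aXW - bXZ - cYW - dYZ - (ad - bc)V)`. -/
abbrev AlgE : Type u := QuotAlg {polyE A}

/-- `𝓧 = R[X,Y,Z,W]/(1 - aXW - bXZ - cYW - dYZ)`. -/
abbrev AlgX : Type u := QuotAlg {polyX A}

/-- `𝓓 = R[X,Y,Z,W]/(1 - aX - bY - cZ - dW, XW - YZ)`. -/
abbrev AlgD : Type u := QuotAlg {polyU A, polyQ R}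

/-- `𝓦 = R[X,Y,Z,W]/(Φ_A)`. -/
abbrev AlgW : Type u := QuotAlg {polyW A}

/-- The element `1 - (ad - bc)(XW - YZ)` of `𝓦`. -/
def elemW : AlgW A :=
  QuotAlg.mk {polyW A} (1 - C (A 0 0 * A 1 1 - A 0 1 * A 1 0) * (X 0 * X 3 - X 1 * X 2))

/-- The images of the variables in `𝓧`. -/
def xX (i : Fin 4) : AlgX A := QuotAlg.mk {polyX A} (X i)

/-- The images of the variables in `𝓓`. -/
def xD (i : Fin 4) : AlgD A := QuotAlg.mk {polyU A, polyQ R} (X i)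

lemma relX : algebraMap R (AlgX A) (A 0 0) * xX A 0 * xX A 3
    + algebraMap R (AlgX A) (A 0 1) * xX A 0 * xX A 2
    + algebraMap R (AlgX A) (A 1 0) * xX A 1 * xX A 3
    + algebraMap R (AlgX A) (A 1 1) * xX A 1 * xX A 2 = 1 := by
  have h : ∀ p, p = polyX A → QuotAlg.mk {polyX A} p = 0 := fun p hp => QuotAlg.mk_eq_zero _ hp
  have h := h _ (by rw [polyX])
  simp only [map_sub, map_mul, map_one, ← MvPolynomial.algebraMap_eq, AlgHom.commutes] at h
  simp only [xX]
  linear_combination -h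

/-- `ρ : 𝓓 → 𝓧` maps `X, Y, Z, W` to `XW, XZ, YW, YZ`. -/
def rho : AlgD A →ₐ[R] AlgX A :=
  QuotAlg.lift _ ![xX A 0 * xX A 3, xX A 0 * xX A 2, xX A 1 * xX A 3, xX A 1 * xX A 2] (by
    rintro q (rfl | rfl)
    · simp [polyU]
      linear_combination - relX A
    · simp [polyQ]
      ring)

/-- `𝓧` is a `𝓓`-algebra via `ρ`. -/
instance algebraDX : Algebra (AlgD A) (AlgX A) := (rho A).toRingHom.toAlgebra

instance scalarTowerDX : IsScalarTower R (AlgD A) (AlgX A) :=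
  IsScalarTower.of_algebraMap_eq fun r => ((rho A).commutes r).symm

lemma algebraMap_xD (i : Fin 4) : algebraMap (AlgD A) (AlgX A) (xD A i) =
    ![xX A 0 * xX A 3, xX A 0 * xX A 2, xX A 1 * xX A 3, xX A 1 * xX A 2] i :=
  aeval_X _ i

/-- The ring `𝓓[T, T⁻¹] ⊗_{𝓓, ρ} 𝓧`. -/
abbrev TensDX : Type u := (AlgD A)[T;T⁻¹] ⊗[AlgD A] AlgX A

/-- The elements `T ⊗ X`, `T ⊗ Y`, `T⁻¹ ⊗ Z`, `T⁻¹ ⊗ W` of `𝓓[T, T⁻¹] ⊗ 𝓧`. -/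
def chiVar : Fin 4 → TensDX A :=
  ![LaurentPolynomial.T 1 ⊗ₜ xX A 0, LaurentPolynomial.T 1 ⊗ₜ xX A 1,
    LaurentPolynomial.T (-1) ⊗ₜ xX A 2, LaurentPolynomial.T (-1) ⊗ₜ xX A 3]

lemma chiVar_mul (i j : Fin 4) (hi : i = 0 ∨ i = 1) (hj : j = 2 ∨ j = 3) :
    chiVar A i * chiVar A j =
      (Algebra.TensorProduct.includeRight : AlgX A →ₐ[AlgD A] TensDX A) (xX A i * xX A j) := by
  have key : ∀ x y : AlgX A, (LaurentPolynomial.T 1 ⊗ₜ x : TensDX A) *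
      (LaurentPolynomial.T (-1) ⊗ₜ y) = 1 ⊗ₜ (x * y) := fun x y => by
    rw [Algebra.TensorProduct.tmul_mul_tmul, ← LaurentPolynomial.T_add, add_neg_cancel,
      LaurentPolynomial.T_zero]
  rcases hi with rfl | rfl <;> rcases hj with rfl | rfl <;> exact key _ _

lemma algebraMap_tens (r : R) : algebraMap R (TensDX A) r =
    (Algebra.TensorProduct.includeRight : AlgX A →ₐ[AlgD A] TensDX A) (algebraMap R (AlgX A) r) := by
  rw [IsScalarTower.algebraMap_apply R (AlgD A) (AlgX A), AlgHom.commutes,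
    ← IsScalarTower.algebraMap_apply]

/-- `χ` as a homomorphism of `R`-algebras: `X, Y, Z, W ↦ T ⊗ X, T ⊗ Y, T⁻¹ ⊗ Z, T⁻¹ ⊗ W`. -/
def chiR : AlgX A →ₐ[R] TensDX A :=
  QuotAlg.lift _ (chiVar A) (by
    rintro q rfl
    have h := congrArg (Algebra.TensorProduct.includeRight : AlgX A →ₐ[AlgD A] TensDX A) (relX A)
    simp only [map_add, map_one, mul_assoc] at h
    simp only [map_mul _ (algebraMap R (AlgX A) _), ← algebraMap_tens] at h
    rw [← chiVar_mul A 0 3 (by simp) (by simp), ← chiVar_mul A 0 2 (by simp) (by simp),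
      ← chiVar_mul A 1 3 (by simp) (by simp), ← chiVar_mul A 1 2 (by simp) (by simp)] at h
    simp only [polyX, map_sub, map_mul, map_one, aeval_X, aeval_C]
    linear_combination -h)

lemma chiR_xX (i : Fin 4) : chiR A (xX A i) = chiVar A i := aeval_X _ i

/-- The homomorphism of `𝓓`-algebras `χ : 𝓧 → 𝓓[T, T⁻¹] ⊗_{𝓓, ρ} 𝓧` that maps `X, Y, Z, W` to
`T ⊗ X, T ⊗ Y, T⁻¹ ⊗ Z, T⁻¹ ⊗ W`. -/
def chi : AlgX A →ₐ[AlgD A] TensDX A where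
  __ := (chiR A).toRingHom
  commutes' := by
    refine RingHom.congr_fun (f := (chiR A).toRingHom.comp (algebraMap (AlgD A) (AlgX A)))
      (g := algebraMap (AlgD A) (TensDX A)) (QuotAlg.hom_ext _ (fun r => ?_) fun i => ?_)
    · change chiR A (algebraMap _ _ (algebraMap _ _ r)) = _
      rw [← IsScalarTower.algebraMap_apply, AlgHom.commutes, ← IsScalarTower.algebraMap_apply]
    · change chiR A (algebraMap _ _ (xD A i)) = algebraMap _ _ (xD A i)
      rw [← (Algebra.TensorProduct.includeRight : AlgX A →ₐ[AlgD A] TensDX A).commutes,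
        algebraMap_xD]
      fin_cases i <;> exact (map_mul _ _ _).trans (by
        rw [chiR_xX, chiR_xX]; exact chiVar_mul A _ _ (by simp) (by simp))

end Algebras

section Torsors

/-- The spectrum of an `R`-algebra `S` as a scheme over `Spec R`. -/
abbrev SpecOver (R S : Type u) [CommRing R] [CommRing S] [Algebra R S] :
    Over (Spec (CommRingCat.of R)) :=
  (Spec (CommRingCat.of S)).asOver (Spec (CommRingCat.of R))

/-- The group scheme `𝔾_{m, R}` over `Spec R`, the spectrum of the Hopf algebra `R[T, T⁻¹]`. -/
abbrev Gm (R : Type u) [CommRing R] : Over (Spec (CommRingCat.of R)) := SpecOver R R[T;T⁻¹]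

/-- The morphism `Spec R' → Spec R`. -/
abbrev specMap (R R' : Type u) [CommRing R] [CommRing R'] [Algebra R R'] :
    Spec (CommRingCat.of R') ⟶ Spec (CommRingCat.of R) :=
  Spec.map (CommRingCat.ofHom (algebraMap R R'))

/-- The morphism `Spec H ×_{Spec R} Spec S → Spec S` that is defined by a homomorphism of
`R`-algebras `S → H ⊗_R S`. -/
def specCoaction {R H S : Type u} [CommRing R] [CommRing H] [CommRing S] [Algebra R H] [Algebra R S]
    (χ : S →ₐ[R] H ⊗[R] S) :
    pullback (specMap R H) (specMap R S) ⟶ Spec (CommRingCat.of S) :=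
  (pullbackSpecIso R H S).hom ≫ Spec.map (CommRingCat.ofHom χ.toRingHom)

lemma specCoaction_comp {R H S : Type u} [CommRing R] [CommRing H] [CommRing S] [Algebra R H]
    [Algebra R S] (χ : S →ₐ[R] H ⊗[R] S) :
    specCoaction χ ≫ specMap R S = pullback.fst _ _ ≫ specMap R H := by
  rw [specCoaction, Category.assoc, ← Spec.map_comp, ← CommRingCat.ofHom_comp,
    ← pullbackSpecIso_hom_fst, Category.assoc, ← Spec.map_comp, ← CommRingCat.ofHom_comp]
  congr 3
  exact χ.comp_algebraMap

/-- The morphism `𝔾_{m, R} ×_{Spec R} Spec S → Spec S` over `Spec R` that is defined by a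
homomorphism of `R`-algebras `S → R[T, T⁻¹] ⊗_R S`. -/
def actionOfCoaction {R S : Type u} [CommRing R] [CommRing S] [Algebra R S]
    (χ : S →ₐ[R] R[T;T⁻¹] ⊗[R] S) : Gm R ⊗ SpecOver R S ⟶ SpecOver R S :=
  Over.homMk (specCoaction χ) (specCoaction_comp χ)

/-- The morphism `act : 𝔾_{m, R} × X → X` of schemes over `Spec R` is an action of the group
scheme `𝔾_{m, R}` on `X`. -/
def IsGmAction {R : Type u} [CommRing R] {X : Over (Spec (CommRingCat.of R))}
    (act : Gm R ⊗ X ⟶ X) : Prop :=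
  ∃ m : ModObj (Gm R) X, m.smul = act

section BaseChange

variable {R : Type u} (R' : Type u) [CommRing R] [CommRing R'] [Algebra R R']

/-- The base change `X ×_{Spec R} Spec R'`, as a scheme over `Spec R'`. -/
abbrev baseChange (X : Over (Spec (CommRingCat.of R))) : Over (Spec (CommRingCat.of R')) :=
  (Over.pullback (specMap R R')).obj X

/-- The projection `𝔾_{m, R'} → 𝔾_{m, R}`. -/
def gmMap : (Gm R').left ⟶ (Gm R).left :=
  Spec.map (CommRingCat.ofHom (AddMonoidAlgebra.mapRingHom ℤ (algebraMap R R')))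

lemma gmMap_comp : (Gm R').hom ≫ specMap R R' = gmMap R' ≫ (Gm R).hom := by
  change Spec.map _ ≫ Spec.map _ = Spec.map _ ≫ Spec.map _
  rw [← Spec.map_comp, ← Spec.map_comp, ← CommRingCat.ofHom_comp, ← CommRingCat.ofHom_comp]
  congr 2
  ext r
  simp

/-- The projection `𝔾_{m, R'} ×_{Spec R'} X_{R'} → 𝔾_{m, R} ×_{Spec R} X`. -/
def actProj (X : Over (Spec (CommRingCat.of R))) :
    (Gm R' ⊗ baseChange R' X).left ⟶ (Gm R ⊗ X).left :=
  pullback.map (Gm R').hom (baseChange R' X).hom (Gm R).hom X.hom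
    (gmMap R') (pullback.fst X.hom (specMap R R')) (specMap R R') (gmMap_comp R')
    (pullback.condition).symm

lemma actProj_comp (X : Over (Spec (CommRingCat.of R))) :
    actProj R' X ≫ (Gm R ⊗ X).hom = (Gm R' ⊗ baseChange R' X).hom ≫ specMap R R' := by
  have h : actProj R' X ≫ pullback.fst (Gm R).hom X.hom =
      pullback.fst (Gm R').hom (baseChange R' X).hom ≫ gmMap R' := pullback.lift_fst _ _ _
  change actProj R' X ≫ pullback.fst (Gm R).hom X.hom ≫ (Gm R).hom =
    (pullback.fst (Gm R').hom (baseChange R' X).hom ≫ (Gm R').hom) ≫ specMap R R'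
  rw [← Category.assoc, h, Category.assoc, Category.assoc, gmMap_comp]

/-- The pullback `𝔾_{m, R'} ×_{Spec R'} X_{R'} → X_{R'}` of a morphism `𝔾_{m, R} ×_{Spec R} X → X`. -/
def actBaseChange {X : Over (Spec (CommRingCat.of R))} (act : Gm R ⊗ X ⟶ X) :
    Gm R' ⊗ baseChange R' X ⟶ baseChange R' X :=
  Over.homMk (pullback.lift (actProj R' X ≫ act.left) (Gm R' ⊗ baseChange R' X).hom (by
    rw [Category.assoc, Over.w act]
    exact actProj_comp R' X)) (by
    exact pullback.lift_snd _ _ _)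

end BaseChange

/-- A scheme `X` over `Spec R` with a morphism `act : 𝔾_{m, R} × X → X` is a `Spec R`-torsor under
`𝔾_{m, R}` in the Zariski topology: `act` is an action, and there is a unimodular tuple
`(f_1, …, f_n)` of elements of `R` such that over each `R_{f_i}` the scheme `X` with its action is
isomorphic to `𝔾_m` acting on itself by multiplication. -/
def IsGmTorsor {R : Type u} [CommRing R] {X : Over (Spec (CommRingCat.of R))}
    (act : Gm R ⊗ X ⟶ X) : Prop :=
  IsGmAction act ∧
  ∃ (n : ℕ) (f : Fin (n + 1) → R), IsUnimodular R f ∧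
    ∀ i, ∃ e : baseChange (Localization.Away (f i)) X ≅ Gm (Localization.Away (f i)),
      actBaseChange (Localization.Away (f i)) act ≫ e.hom =
        (Gm (Localization.Away (f i)) ◁ e.hom) ≫ μ[Gm (Localization.Away (f i))]

end Torsors

end MatrixExt

end

open MatrixExt

/-! ### Smoothness by the Jacobian criterion. -/

namespace MatrixExt

open MvPolynomial Algebra

/-! Smoothness of `𝓤`, `𝓧`, `𝓔`, `𝓓` and the localized `𝓦` is the Jacobian criterion
(`isSmoothOfRelDim_of_jacobian`): the maximal minors generate the unit ideal. For `𝓤` the gradient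
is the unimodular vector itself up to sign; in the other cases Euler's identity for a suitable
grading produces the unit.

Write `v` for the entries of `A`, `q = XW - YZ`, and `H` for `hyperbolicMap`, so that `b(x, y) = Hx
· y` is the polar form of `q`. `Spec 𝓤` is the affine hyperplane `v · x = 1`. Translating by a
solution `w` identifies it with `P`, regarded as a vector bundle, whose linear functions form `P* =
R⁴/Rv`. So `𝓤 ≅ Sym(P*)`, and a symplectic `J` on `R⁴` gives `P* ≅ P`: the vector `Jv` lies in `P`
and spans a summand, and exchanging it with the complement `Rw` of `P` turns `R⁴/R Jv` into `P`.

If `det A = 0`, then `p = Hv` is isotropic, and `w` can be corrected to an isotropic `B` with `b(p,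
B) = 1`. The hyperbolic plane `⟨p, B⟩` splits off with complement `Q` of rank 2, on which `b` is
perfect; hence `Q` is self-dual and `P = p^⊥ = Q ⊕ Rp`. A point of `Spec 𝓓` satisfies `b(p, x) = 1`
and `q(x) = 0`, so it is `B + y - q(y)p` with `y` in `Q` arbitrary: a paraboloid, which is the graph
of a function on `Q`. Thus `𝓓 ≅ Sym(Q*) ≅ Sym(Q)`.

`𝓧` is the universal `𝓓`-algebra in which the rank-one matrix of variables of `𝓓` factors as a
column times a row (`isUniversalFactorization_algX`). Where an entry is invertible, such a
factorization is determined by one unit, so `𝓧` becomes a Laurent polynomial ring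
(`IsUniversalFactorization.exists_laurent_ringEquiv`). The entries generate the unit ideal of `𝓓`,
which gives the torsor and the smoothness of `ρ`. The group action is checked on functions, because
morphisms to an affine scheme are determined by them. -/

theorem isStandardSmoothOfRelativeDimension_of_isUnit_jacobian {R : Type u} [CommRing R]
    {n c d : ℕ} (hd : d + c = n) (v : Fin c → MvPolynomial (Fin n) R) (a : Fin c → Fin n)
    (ha : Function.Injective a) (T : Type u) [CommRing T] [Algebra R T]
    [Algebra (QuotAlg (Set.range v)) T] [IsScalarTower R (QuotAlg (Set.range v)) T]
    (h : QuotAlg (Set.range v)) [IsLocalization.Away h T]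
    (hu : IsUnit (algebraMap (QuotAlg (Set.range v)) T (QuotAlg.mk (Set.range v)
      (Matrix.of fun i j => pderiv (a i) (v j)).det))) :
    Algebra.IsStandardSmoothOfRelativeDimension d R T := by
  let P : PreSubmersivePresentation R (QuotAlg (Set.range v)) (Fin n) (Fin c) :=
    PreSubmersivePresentation.naive a ha
  let L : SubmersivePresentation (QuotAlg (Set.range v)) T Unit Unit :=
    SubmersivePresentation.localizationAway T h
  have hP : P.jacobian = QuotAlg.mk (Set.range v)
      (Matrix.of fun i j => pderiv (a i) (v j)).det := by
    rw [PreSubmersivePresentation.jacobian_eq_jacobiMatrix_det]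
    have : P.jacobiMatrix = Matrix.of fun i j => pderiv (a i) (v j) := by
      ext1 i j
      exact PreSubmersivePresentation.jacobiMatrix_naive a ha _ _ i j
    rw [this]
    have hval : ∀ p : P.Ring, algebraMap P.Ring (QuotAlg (Set.range v)) p =
        QuotAlg.mk (Set.range v) p := fun p => rfl
    exact hval _
  -- Localizing adds one variable and one relation, so the dimension is unchanged, and Jacobians
  -- multiply under composition of presentations.
  let Q : SubmersivePresentation R T (Unit ⊕ Fin n) (Unit ⊕ Fin c) :=
    { toPreSubmersivePresentation := L.toPreSubmersivePresentation.comp P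
      jacobian_isUnit := by
        rw [PreSubmersivePresentation.comp_jacobian_eq_jacobian_smul_jacobian, Algebra.smul_def,
          hP]
        exact hu.mul L.jacobian_isUnit }
  refine Q.isStandardSmoothOfRelativeDimension ?_
  simp [Presentation.dimension]
  omega

/-- The Jacobian criterion: a localization of a complete intersection at which the maximal minors
of the Jacobian matrix generate the unit ideal is smooth. -/
theorem isSmoothOfRelDim_of_jacobian {R : Type u} [CommRing R]
    {n c d : ℕ} (hd : d + c = n) (v : Fin c → MvPolynomial (Fin n) R)
    (s : Set (MvPolynomial (Fin n) R)) (hs : s = Set.range v)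
    (T : Type u) [CommRing T] [Algebra R T]
    [Algebra (QuotAlg s) T] [IsScalarTower R (QuotAlg s) T]
    (h : QuotAlg s) [IsLocalization.Away h T]
    (I : Ideal T) (hI : I = ⊤) (hle : I ≤ Ideal.span (Set.range fun a : Fin c ↪ Fin n =>
      algebraMap (QuotAlg s) T (QuotAlg.mk s
        (Matrix.of fun i j => pderiv (a i) (v j)).det))) :
    IsSmoothOfRelDim d R T := by
  subst hs
  rw [IsSmoothOfRelDim, HasRingHomProperty.Spec_iff (P := @SmoothOfRelativeDimension d)]
  let g : (Fin c ↪ Fin n) → QuotAlg (Set.range v) := fun a =>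
    (QuotAlg.mk _ (Matrix.of fun i j => pderiv (a i) (v j)).det)
  -- The basic opens at the minors cover `Spec T`, and on each of them one choice of columns has an
  -- invertible minor.
  refine RingHom.locally_of_exists RingHom.isStandardSmoothOfRelativeDimension_respectsIso _
    (fun a : Fin c ↪ Fin n => algebraMap (QuotAlg (Set.range v)) T (g a))
    (top_le_iff.1 (hI ▸ hle))
    (fun a => Localization.Away (algebraMap (QuotAlg (Set.range v)) T (g a))) fun a => ?_
  rw [CommRingCat.hom_ofHom, ← IsScalarTower.algebraMap_eq,
    RingHom.isStandardSmoothOfRelativeDimension_algebraMap]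
  let T' := Localization.Away (algebraMap (QuotAlg (Set.range v)) T (g a))
  have : IsLocalization.Away (g a * h) T' := IsLocalization.Away.mul T T' h (g a)
  refine isStandardSmoothOfRelativeDimension_of_isUnit_jacobian hd v a a.injective T' (g a * h) ?_
  rw [IsScalarTower.algebraMap_apply (QuotAlg (Set.range v)) T T']
  exact IsLocalization.Away.algebraMap_isUnit (S := T') (algebraMap (QuotAlg (Set.range v)) T (g a))

/-- With one equation the minors are the partial derivatives, so a combination of these equal to `1`
is a certificate of smoothness. -/
theorem isSmoothOfRelDim_of_hypersurface {R : Type u} [CommRing R] {d : ℕ}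
    (f : MvPolynomial (Fin (d + 1)) R) (T : Type u) [CommRing T] [Algebra R T]
    [Algebra (QuotAlg {f}) T] [IsScalarTower R (QuotAlg {f}) T] (h : QuotAlg {f})
    [IsLocalization.Away h T] (c : Fin (d + 1) → T)
    (p : Fin (d + 1) → MvPolynomial (Fin (d + 1)) R) (hp : ∀ i, pderiv i f = p i)
    (hc : ∑ i, c i * algebraMap (QuotAlg {f}) T (QuotAlg.mk {f} (p i)) = 1) :
    IsSmoothOfRelDim d R T := by
  refine isSmoothOfRelDim_of_jacobian (c := 1) rfl (fun _ => f) _ (by simp) T h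
    _ ((Ideal.eq_top_iff_one _).2 ?_) le_rfl
  rw [← hc]
  refine Ideal.sum_mem _ fun i _ => Ideal.mul_mem_left _ _ (Ideal.subset_span ?_)
  exact ⟨⟨fun _ => i, fun _ _ _ => Subsingleton.elim _ _⟩, by simp [← hp]; rfl⟩

theorem isSmoothOfRelDim_quotAlg_hypersurface {R : Type u} [CommRing R] {d : ℕ}
    (f : MvPolynomial (Fin (d + 1)) R) (c : Fin (d + 1) → QuotAlg {f})
    (p : Fin (d + 1) → MvPolynomial (Fin (d + 1)) R) (hp : ∀ i, pderiv i f = p i)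
    (hc : ∑ i, c i * QuotAlg.mk {f} (p i) = 1) :
    IsSmoothOfRelDim d R (QuotAlg {f}) :=
  have : IsLocalization.Away (1 : QuotAlg {f}) (QuotAlg {f}) :=
    IsLocalization.away_of_isUnit_of_bijective _ isUnit_one Function.bijective_id
  isSmoothOfRelDim_of_hypersurface f _ 1 c p hp hc

variable {R : Type u} [CommRing R] (A : Matrix (Fin 2) (Fin 2) R)

theorem mk_C {n : ℕ} (s : Set (MvPolynomial (Fin n) R)) (r : R) :
    QuotAlg.mk s (C r) = algebraMap R _ r :=
  (QuotAlg.mk s).commutes r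

/-- A unimodular matrix has coefficients `w` with `Λ_A w = 1`. -/
theorem exists_lam_eq_one (hA : IsUnimodular R A) : ∃ w : Fin 4 → R,
    A 0 0 * w 0 + A 0 1 * w 1 + A 1 0 * w 2 + A 1 1 * w 3 = 1 := by
  obtain ⟨L, hL⟩ := hA
  refine ⟨![L (Matrix.single 0 0 1), L (Matrix.single 0 1 1), L (Matrix.single 1 0 1),
    L (Matrix.single 1 1 1)], ?_⟩
  have h : A = A 0 0 • Matrix.single 0 0 1 + A 0 1 • Matrix.single 0 1 1
      + A 1 0 • Matrix.single 1 0 1 + A 1 1 • Matrix.single 1 1 1 := by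
    ext i j
    fin_cases i <;> fin_cases j <;> simp
  have h' := congrArg L h
  simp only [map_add, map_smul, hL, smul_eq_mul] at h'
  exact h'.symm

theorem pderiv_polyU (i : Fin 4) : pderiv i (polyU A) =
    (![-C (A 0 0),
      -C (A 0 1),
      -C (A 1 0),
      -C (A 1 1)] : Fin 4 → MvPolynomial (Fin 4) R) i := by
  fin_cases i <;> simp [polyU, pderiv_X]

theorem pderiv_polyQ (i : Fin 4) : pderiv i (polyQ R) =
    (![X 3,
      -X 2,
      -X 1,
      X 0] : Fin 4 → MvPolynomial (Fin 4) R) i := by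
  fin_cases i <;> simp [polyQ, pderiv_X]

theorem pderiv_polyX (i : Fin 4) : pderiv i (polyX A) =
    (![-(C (A 0 0) * X 3 + C (A 0 1) * X 2),
      -(C (A 1 0) * X 3 + C (A 1 1) * X 2),
      -(C (A 0 1) * X 0 + C (A 1 1) * X 1),
      -(C (A 0 0) * X 0 + C (A 1 0) * X 1)] : Fin 4 → MvPolynomial (Fin 4) R) i := by
  fin_cases i <;> simp [polyX, pderiv_X] <;> ring

theorem pderiv_polyE (i : Fin 5) : pderiv i (polyE A) =
    (![-(C (A 0 0) * X 3 + C (A 0 1) * X 2),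
      -(C (A 1 0) * X 3 + C (A 1 1) * X 2),
      -(C (A 0 1) * X 0 + C (A 1 1) * X 1),
      -(C (A 0 0) * X 0 + C (A 1 0) * X 1),
      -C (A 0 0 * A 1 1 - A 0 1 * A 1 0)] : Fin 5 → MvPolynomial (Fin 5) R) i := by
  fin_cases i <;> simp [polyE, pderiv_X] <;> ring

theorem pderiv_polyW (i : Fin 4) : pderiv i (polyW A) =
    (![-C (A 0 0) + C (A 0 0 * A 1 1 - A 0 1 * A 1 0) * X 3,
      -C (A 0 1) - C (A 0 0 * A 1 1 - A 0 1 * A 1 0) * X 2,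
      -C (A 1 0) - C (A 0 0 * A 1 1 - A 0 1 * A 1 0) * X 1,
      -C (A 1 1) + C (A 0 0 * A 1 1 - A 0 1 * A 1 0) * X 0] : Fin 4 → MvPolynomial (Fin 4) R) i := by
  fin_cases i <;> simp [polyW, pderiv_X] <;> ring

theorem isSmoothOfRelDim_algU (hA : IsUnimodular R A) : IsSmoothOfRelDim 3 R (AlgU A) := by
  obtain ⟨w, hw⟩ := exists_lam_eq_one A hA
  refine isSmoothOfRelDim_quotAlg_hypersurface _ (fun i => - algebraMap R _ (w i)) _ (pderiv_polyU A) ?_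
  have hw' := congrArg (algebraMap R (AlgU A)) hw
  simp only [map_add, map_mul, map_one] at hw'
  simp [Fin.sum_univ_four]
  linear_combination hw'

theorem isSmoothOfRelDim_algX : IsSmoothOfRelDim 3 R (AlgX A) := by
  -- The bilinear form is homogeneous of degree 1 in `X, Y`; Euler's identity in these two variables
  -- returns the form, which is `1`.
  refine isSmoothOfRelDim_quotAlg_hypersurface _ ![-xX A 0, -xX A 1, 0, 0] _ (pderiv_polyX A) ?_
  simp [Fin.sum_univ_four]
  have h := relX A
  simp only [xX] at h ⊢
  linear_combination h

theorem isSmoothOfRelDim_algE : IsSmoothOfRelDim 4 R (AlgE A) := by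
  have h := QuotAlg.mk_eq_zero {polyE A} (Set.mem_singleton _)
  refine isSmoothOfRelDim_quotAlg_hypersurface _
    -- Euler's identity for the grading with weight 1 on `X, Y, V` and weight 0 on `Z, W`.
    ![-QuotAlg.mk _ (X 0), -QuotAlg.mk _ (X 1), 0, 0, -QuotAlg.mk _ (X 4)] _
    (pderiv_polyE A) ?_
  conv at h => lhs; arg 2; rw [polyE]
  simp at h
  simp [Fin.sum_univ_five]
  linear_combination -h

theorem isSmoothOfRelDim_away_algW (T : Type u) [CommRing T] [Algebra R T] [Algebra (AlgW A) T]
    [IsScalarTower R (AlgW A) T] [IsLocalization.Away (elemW A) T] : IsSmoothOfRelDim 3 R T := by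
  have h := QuotAlg.mk_eq_zero {polyW A} (Set.mem_singleton _)
  conv at h => lhs; arg 2; rw [polyW]
  obtain ⟨u, hu⟩ := IsLocalization.Away.algebraMap_isUnit (S := T) (elemW A)
  rw [elemW] at hu
  -- Euler's operator counts the quadratic term twice, so `-∑ X_i ∂_i Φ` equals `1 - (ad - bc)(XW -
  -- YZ)` modulo `Φ`. This is the inverted element, whence the factor `u⁻¹`.
  refine isSmoothOfRelDim_of_hypersurface _ T (elemW A)
    (fun i => - (↑u⁻¹ : T) * algebraMap (AlgW A) T (QuotAlg.mk _ (X i))) _ (pderiv_polyW A) ?_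
  have h := congrArg (algebraMap (AlgW A) T) h
  simp at h hu
  simp [Fin.sum_univ_four]
  linear_combination u.inv_mul - (↑u⁻¹ : T) * h - (↑u⁻¹ : T) * hu

theorem isSmoothOfRelDim_algW (hA : IsNilpotent (A 0 0 * A 1 1 - A 0 1 * A 1 0)) :
    IsSmoothOfRelDim 3 R (AlgW A) := by
  have hu : IsUnit (elemW A) := by
    rw [elemW, map_sub, map_one, map_mul, mk_C]
    refine IsNilpotent.isUnit_one_sub ?_
    exact (Commute.all _ _).isNilpotent_mul_right (hA.map (algebraMap R (AlgW A)))
  have : IsLocalization.Away (elemW A) (AlgW A) :=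
    IsLocalization.away_of_isUnit_of_bijective _ hu Function.bijective_id
  exact isSmoothOfRelDim_away_algW A _

/-- Contracting the 2 × 2 minors with the coordinate vector gives, by Euler's identity for the
linear and the quadratic equation, the partial derivatives of `XW - YZ`. Those are the variables up
to sign, and the linear equation writes `1` as a combination of them. -/
theorem isSmoothOfRelDim_algD : IsSmoothOfRelDim 2 R (AlgD A) := by
  let s := ({polyU A, polyQ R} : Set (MvPolynomial (Fin 4) R))
  have : IsLocalization.Away (1 : AlgD A) (AlgD A) :=
    IsLocalization.away_of_isUnit_of_bijective _ isUnit_one Function.bijective_id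
  let v : Fin 2 → MvPolynomial (Fin 4) R := ![polyU A, polyQ R]
  let m : Fin 4 → Fin 4 → MvPolynomial (Fin 4) R := fun i j =>
    pderiv i (polyU A) * pderiv j (polyQ R) - pderiv j (polyU A) * pderiv i (polyQ R)
  let I : Ideal (AlgD A) := Ideal.span (Set.range fun a : Fin 2 ↪ Fin 4 =>
    QuotAlg.mk s (Matrix.of fun i j => pderiv (a i) (v j)).det)
  refine isSmoothOfRelDim_of_jacobian (c := 2) rfl v s (by simp [v, s, Set.pair_comm])
    (AlgD A) 1 I ?_ le_rfl
  have hm : ∀ i j, QuotAlg.mk s (m i j) ∈ I := fun i j => by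
    by_cases hij : i = j
    · subst hij
      simp [m]
    · refine Ideal.subset_span ⟨⟨![i, j], ?_⟩, ?_⟩
      · intro x y
        fin_cases x <;> fin_cases y <;> simp [hij, Ne.symm hij]
      · change QuotAlg.mk s (Matrix.det (Matrix.of fun k l => pderiv (![i, j] k) (v l))) = _
        simp [Matrix.det_fin_two, v, m]
        ring
  have h1 : QuotAlg.mk s (polyU A) = 0 := QuotAlg.mk_eq_zero _ (by simp [s])
  have h2 : QuotAlg.mk s (polyQ R) = 0 := QuotAlg.mk_eq_zero _ (by simp [s])
  rw [polyU] at h1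
  rw [polyQ] at h2
  have hg : ∀ j, QuotAlg.mk s (pderiv j (polyQ R)) ∈ I := fun j => by
    have : QuotAlg.mk s (pderiv j (polyQ R)) =
        ∑ i, - QuotAlg.mk s (X i) * QuotAlg.mk s (m i j) := by
      simp at h1 h2
      fin_cases j <;>
      simp [Fin.sum_univ_four, m, pderiv_polyU, pderiv_polyQ]
      · linear_combination QuotAlg.mk s (X 3) * h1 + 2 * algebraMap R (QuotAlg s) (A 0 0) * h2
      · linear_combination -QuotAlg.mk s (X 2) * h1 + 2 * algebraMap R (QuotAlg s) (A 0 1) * h2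
      · linear_combination -QuotAlg.mk s (X 1) * h1 + 2 * algebraMap R (QuotAlg s) (A 1 0) * h2
      · linear_combination QuotAlg.mk s (X 0) * h1 + 2 * algebraMap R (QuotAlg s) (A 1 1) * h2
    rw [this]
    exact Ideal.sum_mem _ fun i _ => Ideal.mul_mem_left _ _ (hm i j)
  rw [Ideal.eq_top_iff_one]
  have : (1 : AlgD A) = ∑ i, (![algebraMap R _ (A 1 1), -algebraMap R _ (A 1 0),
      -algebraMap R _ (A 0 1), algebraMap R _ (A 0 0)] i) *
      QuotAlg.mk s (pderiv i (polyQ R)) := by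
    simp at h1
    simp [Fin.sum_univ_four, pderiv_polyQ]
    linear_combination h1
  rw [this]
  exact Ideal.sum_mem _ fun i _ => Ideal.mul_mem_left _ _ (hg i)

end MatrixExt

/-! ### Localization at an entry: polynomial coordinates. -/

namespace MatrixExt

open MvPolynomial

/-- Since `f` is already invertible in the target, `φ` extends to the localization; both composites
can then be compared on `S` and on the variables, before localizing. -/
theorem nonempty_locAway_algEquiv_mvPolynomial {R : Type u} [CommRing R] (f : R) {S : Type u}
    [CommRing S] [Algebra R S] {n : ℕ} (φ : S →ₐ[R] MvPolynomial (Fin n) (Localization.Away f))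
    (s : Fin n → S)
    (h₁ : ((aeval (R := Localization.Away f) fun i =>
      algebraMap S (LocAway f S) (s i)).restrictScalars R).comp φ =
        IsScalarTower.toAlgHom R S (LocAway f S))
    (h₂ : ∀ i, φ (s i) = X i) :
    Nonempty (LocAway f S ≃ₐ[Localization.Away f]
      MvPolynomial (Fin n) (Localization.Away f)) := by
  let M := Algebra.algebraMapSubmonoid S (Submonoid.powers f)
  have hM : ∀ y : M, IsUnit (φ.toRingHom y) := by
    rintro ⟨_, r, hr, rfl⟩
    change IsUnit (φ (algebraMap R S r))
    rw [AlgHom.commutes, IsScalarTower.algebraMap_apply R (Localization.Away f)]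
    exact (IsLocalization.map_units (Localization.Away f)
      (⟨r, hr⟩ : Submonoid.powers f)).map _
  let L : LocAway f S →+* MvPolynomial (Fin n) (Localization.Away f) := IsLocalization.lift hM
  have hL : ∀ x, L (algebraMap S _ x) = φ x := fun x => IsLocalization.lift_eq hM x
  have hLr : ∀ r, L (algebraMap (Localization.Away f) _ r) = algebraMap _ _ r := by
    intro r
    have : L.comp (algebraMap (Localization.Away f) _) = algebraMap _ _ := by
      refine IsLocalization.ringHom_ext (Submonoid.powers f) (RingHom.ext fun r => ?_)
      rw [RingHom.comp_apply, RingHom.comp_apply, RingHom.comp_apply,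
        ← IsScalarTower.algebraMap_apply, ← IsScalarTower.algebraMap_apply,
        IsScalarTower.algebraMap_apply R S, hL, AlgHom.commutes]
    exact RingHom.congr_fun this r
  let L' : LocAway f S →ₐ[Localization.Away f] MvPolynomial (Fin n) (Localization.Away f) :=
    { L with commutes' := hLr }
  refine ⟨AlgEquiv.ofAlgHom L' (aeval fun i => algebraMap S (LocAway f S) (s i)) ?_ ?_⟩
  · ext i
    simp only [AlgHom.comp_apply, aeval_X, AlgHom.id_apply]
    change coeff _ (L _) = _
    rw [hL, h₂]
  · refine AlgHom.coe_ringHom_injective (IsLocalization.ringHom_ext M (RingHom.ext fun x => ?_))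
    change aeval _ (L (algebraMap S _ x)) = _
    rw [hL]
    exact AlgHom.congr_fun h₁ x

/-- `S` is generated by `x` with the single relation `∑ v i * x i = 1`. -/
structure IsUniversalU {R : Type u} [CommRing R] (v : Fin 4 → R) (S : Type u) [CommRing S]
    [Algebra R S] (x : Fin 4 → S) : Prop where
  hom_ext : ∀ (T : Type u) [CommRing T] [Algebra R T] (f g : S →ₐ[R] T),
    (∀ i, f (x i) = g (x i)) → f = g
  exists_hom : ∀ (T : Type u) [CommRing T] [Algebra R T] (t : Fin 4 → T),
    algebraMap R T (v 0) * t 0 + algebraMap R T (v 1) * t 1 + algebraMap R T (v 2) * t 2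
      + algebraMap R T (v 3) * t 3 = 1 → ∃ f : S →ₐ[R] T, ∀ i, f (x i) = t i
  rel : algebraMap R S (v 0) * x 0 + algebraMap R S (v 1) * x 1 + algebraMap R S (v 2) * x 2
      + algebraMap R S (v 3) * x 3 = 1

/-- `S` is generated by `x` with the relations `∑ v i * x i = 1` and `x 0 * x 3 = x 1 * x 2`. -/
structure IsUniversalD {R : Type u} [CommRing R] (v : Fin 4 → R) (S : Type u) [CommRing S]
    [Algebra R S] (x : Fin 4 → S) : Prop where
  hom_ext : ∀ (T : Type u) [CommRing T] [Algebra R T] (f g : S →ₐ[R] T),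
    (∀ i, f (x i) = g (x i)) → f = g
  exists_hom : ∀ (T : Type u) [CommRing T] [Algebra R T] (t : Fin 4 → T),
    algebraMap R T (v 0) * t 0 + algebraMap R T (v 1) * t 1 + algebraMap R T (v 2) * t 2
      + algebraMap R T (v 3) * t 3 = 1 → t 0 * t 3 = t 1 * t 2 →
      ∃ f : S →ₐ[R] T, ∀ i, f (x i) = t i
  rel : algebraMap R S (v 0) * x 0 + algebraMap R S (v 1) * x 1 + algebraMap R S (v 2) * x 2
      + algebraMap R S (v 3) * x 3 = 1
  rel' : x 0 * x 3 = x 1 * x 2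

theorem exists_algebraMap_mul_eq_one {R : Type u} [CommRing R] (f : R) (T : Type u) [CommRing T]
    [Algebra R T] [Algebra (Localization.Away f) T] [IsScalarTower R (Localization.Away f) T] :
    algebraMap (Localization.Away f) T (IsLocalization.Away.invSelf f) * algebraMap R T f = 1 := by
  rw [IsScalarTower.algebraMap_apply R (Localization.Away f) T, ← map_mul, mul_comm,
    IsLocalization.Away.mul_invSelf, map_one]

/-- Where `v 0` is invertible, the linear relation is solved for `x 0`, leaving the other three
generators free. -/
theorem IsUniversalU.nonempty_algEquiv {R : Type u} [CommRing R] {v : Fin 4 → R} {S : Type u}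
    [CommRing S] [Algebra R S] {x : Fin 4 → S} (h : IsUniversalU v S x) :
    Nonempty (LocAway (v 0) S ≃ₐ[Localization.Away (v 0)]
      MvPolynomial (Fin 3) (Localization.Away (v 0))) := by
  let P := MvPolynomial (Fin 3) (Localization.Away (v 0))
  let g : Localization.Away (v 0) := IsLocalization.Away.invSelf (v 0)
  have hg := exists_algebraMap_mul_eq_one (v 0) P
  obtain ⟨φ, hφ⟩ := h.exists_hom P
    ![algebraMap (Localization.Away (v 0)) P g * (1 - algebraMap R P (v 1) * X 0
      - algebraMap R P (v 2) * X 1 - algebraMap R P (v 3) * X 2), X 0, X 1, X 2] (by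
      simp
      linear_combination (1 - algebraMap R P (v 1) * X 0
      - algebraMap R P (v 2) * X 1 - algebraMap R P (v 3) * X 2) * hg)
  refine nonempty_locAway_algEquiv_mvPolynomial (v 0) φ ![x 1, x 2, x 3] ?_ ?_
  · refine h.hom_ext _ _ _ fun i => ?_
    have h' := congrArg (algebraMap S (LocAway (v 0) S)) h.rel
    have hg' := exists_algebraMap_mul_eq_one (v 0) (LocAway (v 0) S)
    simp only [map_add, map_mul, map_one, ← IsScalarTower.algebraMap_apply] at h'
    rw [AlgHom.comp_apply, hφ]
    fin_cases i
    · simp [P]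
      simp only [← IsScalarTower.algebraMap_apply R]
      linear_combination algebraMap S (LocAway (v 0) S) (x 0) * hg' -
        algebraMap (Localization.Away (v 0)) (LocAway (v 0) S) g * h'
    all_goals simp
  · intro i
    fin_cases i <;> simp [hφ]

/-- The coordinates are `y = v 0 * x 1 + v 2 * x 3` and `z = v 0 * x 2 + v 1 * x 3`. Expanding with
`x 1 * x 2 = x 0 * x 3` and `v 1 * v 2 = v 0 * v 3` gives `y * z = v 0 * x 3 * (∑ v i * x i) = v 0 *
x 3`. So `x 3`, then `x 1` and `x 2`, and finally `x 0` are recovered by dividing by `v 0`. -/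
theorem IsUniversalD.nonempty_algEquiv {R : Type u} [CommRing R] {v : Fin 4 → R} {S : Type u}
    [CommRing S] [Algebra R S] {x : Fin 4 → S} (h : IsUniversalD v S x)
    (hv : v 0 * v 3 = v 1 * v 2) :
    Nonempty (LocAway (v 0) S ≃ₐ[Localization.Away (v 0)]
      MvPolynomial (Fin 2) (Localization.Away (v 0))) := by
  let P := MvPolynomial (Fin 2) (Localization.Away (v 0))
  let g' : Localization.Away (v 0) := IsLocalization.Away.invSelf (v 0)
  let g : P := algebraMap (Localization.Away (v 0)) P g'
  have hg : g * algebraMap R P (v 0) = 1 := exists_algebraMap_mul_eq_one (v 0) P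
  have hvP := congrArg (algebraMap R P) hv
  simp only [map_mul] at hvP
  let y : P := X 0
  let z : P := X 1
  let t₃ : P := g * (y * z)
  let t₁ : P := g * (y - algebraMap R P (v 2) * t₃)
  let t₂ : P := g * (z - algebraMap R P (v 1) * t₃)
  obtain ⟨φ, hφ⟩ := h.exists_hom P
    ![g * (1 - algebraMap R P (v 1) * t₁ - algebraMap R P (v 2) * t₂ - algebraMap R P (v 3) * t₃),
      t₁, t₂, t₃] (by
      change _ * (_ * _) + _ * t₁ + _ * t₂ + _ * t₃ = _
      linear_combination (1 - algebraMap R P (v 1) * t₁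
      - algebraMap R P (v 2) * t₂ - algebraMap R P (v 3) * t₃) * hg) (by
      change g * (_ - _ * t₁ - _ * t₂ - _ * t₃) * t₃ = t₁ * t₂
      simp only [t₁, t₂, t₃]
      linear_combination g ^ 2 * y ^ 2 * z ^ 2 * (- g ^ 2 * hvP + algebraMap R P (v 3) * g * hg))
  refine nonempty_locAway_algEquiv_mvPolynomial (v 0) φ
    ![algebraMap R S (v 0) * x 1 + algebraMap R S (v 2) * x 3,
      algebraMap R S (v 0) * x 2 + algebraMap R S (v 1) * x 3] ?_ ?_
  · let T := LocAway (v 0) S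
    have h' := congrArg (algebraMap S T) h.rel
    have hr := congrArg (algebraMap S T) h.rel'
    have hvT := congrArg (algebraMap R T) hv
    let k : T := algebraMap (Localization.Away (v 0)) T g'
    have hk : k * algebraMap R T (v 0) = 1 := exists_algebraMap_mul_eq_one (v 0) T
    simp only [map_add, map_mul, map_one, ← IsScalarTower.algebraMap_apply] at h' hr hvT
    let a : Fin 4 → T := fun i => algebraMap R T (v i)
    let X' : Fin 4 → T := fun i => algebraMap S T (x i)
    change a 0 * X' 0 + a 1 * X' 1 + a 2 * X' 2 + a 3 * X' 3 = 1 at h'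
    change X' 0 * X' 3 = X' 1 * X' 2 at hr
    change a 0 * a 3 = a 1 * a 2 at hvT
    change k * a 0 = 1 at hk
    let ψ : P →ₐ[Localization.Away (v 0)] T := aeval fun i => algebraMap S T
      ((![algebraMap R S (v 0) * x 1 + algebraMap R S (v 2) * x 3,
        algebraMap R S (v 0) * x 2 + algebraMap R S (v 1) * x 3] : Fin 2 → S) i)
    have hψ : ∀ r : R, ψ (algebraMap R P r) = algebraMap R T r := fun r =>
      (ψ.restrictScalars R).commutes r
    have hψg : ψ g = k := ψ.commutes g'
    have hy : ψ y = a 0 * X' 1 + a 2 * X' 3 := by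
      refine (aeval_X _ (0 : Fin 2)).trans ?_
      change algebraMap S T (algebraMap R S (v 0) * x 1 + algebraMap R S (v 2) * x 3) = _
      rw [map_add, map_mul, map_mul, ← IsScalarTower.algebraMap_apply R S T,
        ← IsScalarTower.algebraMap_apply R S T]
    have hz : ψ z = a 0 * X' 2 + a 1 * X' 3 := by
      refine (aeval_X _ (1 : Fin 2)).trans ?_
      change algebraMap S T (algebraMap R S (v 0) * x 2 + algebraMap R S (v 1) * x 3) = _
      rw [map_add, map_mul, map_mul, ← IsScalarTower.algebraMap_apply R S T,
        ← IsScalarTower.algebraMap_apply R S T]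
    have h₃ : ψ t₃ = X' 3 := by
      simp only [t₃, map_mul, hy, hz, hψg]
      linear_combination X' 3 * hk + k * X' 3 * a 0 * h' - k * a 0 ^ 2 * hr - k * X' 3 ^ 2 * hvT
    have h₁ : ψ t₁ = X' 1 := by
      simp only [t₁, map_mul, map_sub, hy, hψg, h₃, hψ]
      linear_combination X' 1 * hk
    have h₂ : ψ t₂ = X' 2 := by
      simp only [t₂, map_mul, map_sub, hz, hψg, h₃, hψ]
      linear_combination X' 2 * hk
    refine h.hom_ext _ _ _ fun i => ?_
    rw [AlgHom.comp_apply, hφ]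
    fin_cases i
    · change ψ (g * (1 - algebraMap R P (v 1) * t₁ - algebraMap R P (v 2) * t₂
        - algebraMap R P (v 3) * t₃)) = X' 0
      simp only [map_mul, map_sub, map_one, hψg, h₁, h₂, h₃, hψ]
      linear_combination X' 0 * hk - k * h'
    · exact h₁
    · exact h₂
    · exact h₃
  · intro i
    fin_cases i
    · change φ (algebraMap R S (v 0) * x 1 + algebraMap R S (v 2) * x 3) = y
      rw [map_add, map_mul, map_mul, hφ, hφ, AlgHom.commutes, AlgHom.commutes]
      change _ * t₁ + _ * t₃ = y
      simp only [t₁]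
      linear_combination (y - algebraMap R P (v 2) * t₃) * hg
    · change φ (algebraMap R S (v 0) * x 2 + algebraMap R S (v 1) * x 3) = z
      rw [map_add, map_mul, map_mul, hφ, hφ, AlgHom.commutes, AlgHom.commutes]
      change _ * t₂ + _ * t₃ = z
      simp only [t₂]
      linear_combination (z - algebraMap R P (v 1) * t₃) * hg

theorem quotAlg_algHom_ext {R : Type u} [CommRing R] {n : ℕ} (s : Set (MvPolynomial (Fin n) R))
    {T : Type u} [CommRing T] [Algebra R T] {f g : QuotAlg s →ₐ[R] T}
    (h : ∀ i, f (QuotAlg.mk s (X i)) = g (QuotAlg.mk s (X i))) : f = g :=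
  AlgHom.coe_ringHom_injective (QuotAlg.hom_ext s
    (fun r => (f.commutes r).trans (g.commutes r).symm) h)

variable {R : Type u} [CommRing R] (A : Matrix (Fin 2) (Fin 2) R)

/-- The entries of a matrix, in the order of the variables. -/
def entries : Fin 4 → R := ![A 0 0, A 0 1, A 1 0, A 1 1]

theorem isUniversalU_algU :
    IsUniversalU (entries A) (AlgU A) fun i => QuotAlg.mk {polyU A} (X i) where
  hom_ext T _ _ f g h := quotAlg_algHom_ext _ h
  exists_hom T _ _ t ht := by
    refine ⟨QuotAlg.lift _ t ?_, fun i => aeval_X t i⟩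
    rintro p rfl
    simp [entries] at ht
    simp [polyU]
    linear_combination -ht
  rel := by
    have h : ∀ p, p = polyU A → QuotAlg.mk {polyU A} p = 0 := fun p hp => QuotAlg.mk_eq_zero _ hp
    have h := h _ (by rw [polyU])
    simp at h
    simp [entries]
    linear_combination -h

theorem isUniversalD_algD : IsUniversalD (entries A) (AlgD A) (xD A) where
  hom_ext T _ _ f g h := quotAlg_algHom_ext _ h
  exists_hom T _ _ t ht ht' := by
    refine ⟨QuotAlg.lift _ t ?_, fun i => aeval_X t i⟩
    rintro p (rfl | rfl)
    · simp [entries] at ht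
      simp [polyU]
      linear_combination -ht
    · simp [polyQ]
      linear_combination ht'
  rel := by
    have h : ∀ p, p = polyU A → QuotAlg.mk {polyU A, polyQ R} p = 0 :=
      fun p hp => QuotAlg.mk_eq_zero _ (Or.inl hp)
    have h := h _ (by rw [polyU])
    simp at h
    simp [entries, xD]
    linear_combination -h
  rel' := by
    have h : ∀ p, p = polyQ R → QuotAlg.mk {polyU A, polyQ R} p = 0 :=
      fun p hp => QuotAlg.mk_eq_zero _ (Or.inr hp)
    have h := h _ (by rw [polyQ])
    simp at h
    simp [xD]
    linear_combination h

variable {S : Type u} [CommRing S] [Algebra R S]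

/-- A rearrangement of the variables that preserves the set of relations. -/
theorem IsUniversalU.perm {v : Fin 4 → R} {x : Fin 4 → S} (h : IsUniversalU v S x)
    (σ : Equiv.Perm (Fin 4)) : IsUniversalU (v ∘ σ) S (x ∘ σ) where
  hom_ext T _ _ f g hfg := h.hom_ext T f g fun i => by simpa using hfg (σ.symm i)
  exists_hom T _ _ t ht := by
    obtain ⟨f, hf⟩ := h.exists_hom T (t ∘ σ.symm) (by
      have := Equiv.sum_comp σ fun i => algebraMap R T (v i) * t (σ.symm i)
      simp [Fin.sum_univ_four] at this
      simpa [← this] using ht)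
    exact ⟨f, fun i => by simpa using hf (σ i)⟩
  rel := by
    have := Equiv.sum_comp σ fun i => algebraMap R S (v i) * x i
    simp only [Fin.sum_univ_four] at this
    exact this.trans h.rel

/-- Only symmetries of the quadric are admissible here; exchanging columns, rows, or `X` with `W`
suffices to bring any entry to position `0`. -/
theorem IsUniversalD.perm {v : Fin 4 → R} {x : Fin 4 → S} (h : IsUniversalD v S x)
    (σ : Equiv.Perm (Fin 4)) (hσ : ∀ (T : Type u) [CommRing T] (t : Fin 4 → T),
      t (σ 0) * t (σ 3) = t (σ 1) * t (σ 2) ↔ t 0 * t 3 = t 1 * t 2) :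
    IsUniversalD (v ∘ σ) S (x ∘ σ) where
  hom_ext T _ _ f g hfg := h.hom_ext T f g fun i => by simpa using hfg (σ.symm i)
  exists_hom T _ _ t ht ht' := by
    obtain ⟨f, hf⟩ := h.exists_hom T (t ∘ σ.symm) (by
      have := Equiv.sum_comp σ fun i => algebraMap R T (v i) * t (σ.symm i)
      simp [Fin.sum_univ_four] at this
      simpa [← this] using ht) ((hσ T _).1 (by simpa using ht'))
    exact ⟨f, fun i => by simpa using hf (σ i)⟩
  rel := by
    have := Equiv.sum_comp σ fun i => algebraMap R S (v i) * x i
    simp only [Fin.sum_univ_four] at this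
    exact this.trans h.rel
  rel' := (hσ S x).2 h.rel'

theorem nonempty_locAway_algU_algEquiv (i j : Fin 2) :
    Nonempty (LocAway (A i j) (AlgU A) ≃ₐ[Localization.Away (A i j)]
      MvPolynomial (Fin 3) (Localization.Away (A i j))) := by
  have key : ∀ (σ : Equiv.Perm (Fin 4)) (a : R), entries A (σ 0) = a →
      Nonempty (LocAway a (AlgU A) ≃ₐ[Localization.Away a]
        MvPolynomial (Fin 3) (Localization.Away a)) := by
    rintro σ _ rfl
    exact ((isUniversalU_algU A).perm σ).nonempty_algEquiv
  fin_cases i <;> fin_cases j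
  · exact key (Equiv.refl _) _ rfl
  · exact key (Equiv.swap 0 1) _ (by simp [entries])
  · exact key (Equiv.swap 0 2) _ (by simp [entries])
  · exact key (Equiv.swap 0 3) _ (by simp [entries])

theorem nonempty_locAway_algD_algEquiv (hA : A.det = 0) (i j : Fin 2) :
    Nonempty (LocAway (A i j) (AlgD A) ≃ₐ[Localization.Away (A i j)]
      MvPolynomial (Fin 2) (Localization.Away (A i j))) := by
  have h : entries A 0 * entries A 3 = entries A 1 * entries A 2 := by
    rw [Matrix.det_fin_two] at hA
    change A 0 0 * A 1 1 = A 0 1 * A 1 0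
    linear_combination hA
  have key : ∀ (σ : Equiv.Perm (Fin 4)) (_ : ∀ (T : Type u) [CommRing T] (t : Fin 4 → T),
      t (σ 0) * t (σ 3) = t (σ 1) * t (σ 2) ↔ t 0 * t 3 = t 1 * t 2) (a : R),
      entries A (σ 0) = a → Nonempty (LocAway a (AlgD A) ≃ₐ[Localization.Away a]
        MvPolynomial (Fin 2) (Localization.Away a)) := by
    rintro σ hσ _ rfl
    exact ((isUniversalD_algD A).perm σ hσ).nonempty_algEquiv ((hσ R (entries A)).2 h)
  fin_cases i <;> fin_cases j
  · exact key (Equiv.refl _) (fun _ _ _ => Iff.rfl) _ rfl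
  · exact key (Equiv.swap 0 1 * Equiv.swap 2 3) (fun _ _ _ => eq_comm) _ rfl
  · refine key (Equiv.swap 0 2 * Equiv.swap 1 3) (fun T _ t => ?_) _ rfl
    change t 2 * t 1 = t 3 * t 0 ↔ _
    rw [mul_comm (t 2), mul_comm (t 3), eq_comm]
  · refine key (Equiv.swap 0 3) (fun T _ t => ?_) _ (by simp [entries])
    change t 3 * t 0 = t 1 * t 2 ↔ _
    rw [mul_comm (t 3)]

end MatrixExt

/-! ### Projective modules and symmetric algebras. -/

namespace MatrixExt

open MvPolynomial

/-- `M` is a direct summand of a free module and stalk ranks add. The rank count is needed only for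
nontrivial `R`, as the zero ring has no primes. -/
theorem isProjectiveOfRank_of_prod_equiv {R M N F : Type u} [CommRing R] [AddCommGroup M]
    [Module R M] [AddCommGroup N] [Module R N] [AddCommGroup F] [Module R F] [Module.Free R N]
    [Module.Finite R N] [Module.Free R F] [Module.Finite R F] (e : (M × N) ≃ₗ[R] F) (n : ℕ)
    (hn : Nontrivial R → n + Module.finrank R N = Module.finrank R F) :
    IsProjectiveOfRank n R M := by
  have hs : (LinearMap.fst R M N ∘ₗ e.symm.toLinearMap) ∘ₗ (e.toLinearMap ∘ₗ LinearMap.inl R M N) =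
      LinearMap.id := by
    ext x
    simp
  have hsurj : Function.Surjective (LinearMap.fst R M N ∘ₗ e.symm.toLinearMap) :=
    Prod.fst_surjective.comp e.symm.surjective
  have h₁ : Module.Finite R M := Module.Finite.of_surjective _ hsurj
  have h₂ : Module.Projective R M := Module.Projective.of_split _ _ hs
  refine ⟨h₁, h₂, fun p => ?_⟩
  have : Nontrivial R := p.nontrivial
  have h := Module.rankAtStalk_eq_of_equiv e
  rw [Module.rankAtStalk_prod, Module.rankAtStalk_eq_finrank_of_free (M := N),
    Module.rankAtStalk_eq_finrank_of_free (M := F)] at h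
  have h' := congrFun h p
  simp only [Pi.add_apply, Pi.natCast_apply] at h'
  have := hn ‹_›
  have : Module.rankAtStalk M p + Module.finrank R N = n + Module.finrank R N := by
    rw [this]; exact_mod_cast h'
  simpa using this

theorem sum_smul_single {R M : Type u} [CommRing R] [AddCommGroup M] [Module R M]
    (ξ : (Fin 4 → R) →ₗ[R] M) (v : Fin 4 → R) :
    ∑ i, v i • ξ (Pi.single i 1) = ξ v := by
  conv_rhs => rw [LinearMap.pi_apply_eq_sum_univ ξ v]
  refine Finset.sum_congr rfl fun i _ => ?_
  congr 2
  ext j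
  simp [Pi.single_apply, eq_comm]

section Sym

variable {R S M : Type u} [CommRing R] [CommRing S] [Algebra R S] [AddCommGroup M] [Module R M]

/-- The linear map `y ↦ ∑ j, ψ y j * (x j - w j)`. -/
def shiftedForm (ψ : M →ₗ[R] (Fin 4 → R)) (w : Fin 4 → R) (x : Fin 4 → S) : M →ₗ[R] S :=
  ∑ j, ((LinearMap.toSpanSingleton R S (x j - algebraMap R S (w j))) ∘ₗ LinearMap.proj j) ∘ₗ ψ

theorem shiftedForm_apply (ψ : M →ₗ[R] (Fin 4 → R)) (w : Fin 4 → R) (x : Fin 4 → S) (y : M) :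
    shiftedForm ψ w x y = ∑ j, algebraMap R S (ψ y j) * (x j - algebraMap R S (w j)) := by
  simp [shiftedForm, Algebra.smul_def]

theorem sum_algebraMap_mul_single (i : Fin 4) (x : Fin 4 → S) :
    algebraMap R S ((Pi.single i 1 : Fin 4 → R) 0) * x 0
      + algebraMap R S ((Pi.single i 1 : Fin 4 → R) 1) * x 1
      + algebraMap R S ((Pi.single i 1 : Fin 4 → R) 2) * x 2
      + algebraMap R S ((Pi.single i 1 : Fin 4 → R) 3) * x 3 = x i := by
  fin_cases i <;> simp

theorem sum_algebraMap_mul_apply_single (l : M →ₗ[R] S) (ξ : (Fin 4 → R) →ₗ[R] M)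
    (u : Fin 4 → R) : algebraMap R S (u 0) * l (ξ (Pi.single 0 1))
      + algebraMap R S (u 1) * l (ξ (Pi.single 1 1))
      + algebraMap R S (u 2) * l (ξ (Pi.single 2 1))
      + algebraMap R S (u 3) * l (ξ (Pi.single 3 1)) = l (ξ u) := by
  conv_rhs => rw [← sum_smul_single, map_sum, Fin.sum_univ_four]
  simp only [map_smul, Algebra.smul_def]

variable {Y : Type u} [CommRing Y] [Algebra R Y] {l : M →ₗ[R] Y}

/-- The hypotheses say that `ξ` presents `M` as `R⁴/Rv`, the linear functions on `ker v`, and that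
`ψ` is its section with image `ker w`. The isomorphism is the translation `x = w + y` of the
hyperplane `v · x = 1` to `ker v`. -/
theorem IsUniversalU.nonempty_algEquiv_of_isSymmetricAlgebra {v : Fin 4 → R} {x : Fin 4 → S}
    (h : IsUniversalU v S x) (hl : IsSymmetricAlgebra l) (w : Fin 4 → R)
    (hw : v 0 * w 0 + v 1 * w 1 + v 2 * w 2 + v 3 * w 3 = 1)
    (ξ : (Fin 4 → R) →ₗ[R] M) (ψ : M →ₗ[R] (Fin 4 → R)) (h₁ : ξ v = 0) (h₂ : ∀ y, ξ (ψ y) = y)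
    (h₃ : ∀ i j, ψ (ξ (Pi.single i 1)) j = (Pi.single i 1 : Fin 4 → R) j - w i * v j) :
    Nonempty (S ≃ₐ[R] Y) := by
  have hv := sum_algebraMap_mul_apply_single l ξ v
  rw [h₁, map_zero] at hv
  have hw' := congrArg (algebraMap R Y) hw
  simp only [map_add, map_mul, map_one] at hw'
  obtain ⟨f, hf⟩ := h.exists_hom Y (fun i => algebraMap R Y (w i) + l (ξ (Pi.single i 1))) (by
    linear_combination hv + hw')
  let g : Y →ₐ[R] S := hl.lift (shiftedForm ψ w x)
  have hg : ∀ y, g (l y) = algebraMap R S (ψ y 0) * (x 0 - algebraMap R S (w 0))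
      + algebraMap R S (ψ y 1) * (x 1 - algebraMap R S (w 1))
      + algebraMap R S (ψ y 2) * (x 2 - algebraMap R S (w 2))
      + algebraMap R S (ψ y 3) * (x 3 - algebraMap R S (w 3)) := fun y => by
    rw [← Fin.sum_univ_four fun j => algebraMap R S (ψ y j) * (x j - algebraMap R S (w j)),
      ← shiftedForm_apply]
    exact hl.lift_eq _ y
  refine ⟨AlgEquiv.ofAlgHom f g (hl.algHom_ext (LinearMap.ext fun y => ?_))
    (h.hom_ext _ _ _ fun i => ?_)⟩
  · have := sum_algebraMap_mul_apply_single l ξ (ψ y)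
    rw [h₂] at this
    change f (g (l y)) = l y
    simpa only [hg, map_add, map_mul, map_sub, AlgHom.commutes, hf, add_sub_cancel_left] using this
  · simp only [AlgHom.comp_apply, hf, map_add, AlgHom.commutes, AlgHom.id_apply, hg, h₃, map_sub,
      map_mul]
    have hwS := congrArg (algebraMap R S) hw
    simp only [map_add, map_mul, map_one] at hwS
    linear_combination sum_algebraMap_mul_single (R := R) i x - sum_algebraMap_mul_single (R := R) i
      (fun j => algebraMap R S (w j)) + algebraMap R S (w i) * (hwS - h.rel)

/-- Here `M` is the module of linear functions on the complement of the hyperbolic plane `⟨p, B⟩`,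
and the isomorphism is the parametrization `x = B + y - q(y) p` of the quadric section. -/
theorem IsUniversalD.nonempty_algEquiv_of_isSymmetricAlgebra {v : Fin 4 → R} {x : Fin 4 → S}
    (h : IsUniversalD v S x) (hl : IsSymmetricAlgebra l) (p B : Fin 4 → R)
    (hv : v = ![p 3, -p 2, -p 1, p 0])
    (hB : B 0 * B 3 = B 1 * B 2) (hp : p 0 * p 3 = p 1 * p 2)
    (hpB : v 0 * B 0 + v 1 * B 1 + v 2 * B 2 + v 3 * B 3 = 1)
    (ξ : (Fin 4 → R) →ₗ[R] M) (ψ : M →ₗ[R] (Fin 4 → R)) (h₁ : ξ v = 0)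
    (h₁' : ξ ![B 3, -B 2, -B 1, B 0] = 0) (h₂ : ∀ y, ξ (ψ y) = y)
    (h₂' : ∀ y, ψ y 0 * p 0 + ψ y 1 * p 1 + ψ y 2 * p 2 + ψ y 3 * p 3 = 0)
    (h₃ : ∀ i j, ψ (ξ (Pi.single i 1)) j = (Pi.single i 1 : Fin 4 → R) j - B i * v j
      - p i * (![B 3, -B 2, -B 1, B 0] : Fin 4 → R) j) :
    Nonempty (S ≃ₐ[R] Y) := by
  subst hv
  have hav := sum_algebraMap_mul_apply_single l ξ ![p 3, -p 2, -p 1, p 0]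
  have haB := sum_algebraMap_mul_apply_single l ξ ![B 3, -B 2, -B 1, B 0]
  let a : Fin 4 → Y := fun i => l (ξ (Pi.single i 1))
  have hpBY := congrArg (algebraMap R Y) hpB
  have hBY := congrArg (algebraMap R Y) hB
  have hpY := congrArg (algebraMap R Y) hp
  simp [h₁, h₁'] at hpBY hBY hpY hav haB
  let q : Y := a 0 * a 3 - a 1 * a 2
  obtain ⟨f, hf⟩ := h.exists_hom Y
    (fun i => algebraMap R Y (B i) + a i - q * algebraMap R Y (p i)) (by
      simp
      linear_combination hpBY + hav - 2 * q * hpY) (by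
      simp only [q]
      linear_combination hBY + haB - q * hpBY - q * hav + q ^ 2 * hpY)
  let g : Y →ₐ[R] S := hl.lift (shiftedForm ψ B x)
  have hg : ∀ y, g (l y) = algebraMap R S (ψ y 0) * (x 0 - algebraMap R S (B 0))
      + algebraMap R S (ψ y 1) * (x 1 - algebraMap R S (B 1))
      + algebraMap R S (ψ y 2) * (x 2 - algebraMap R S (B 2))
      + algebraMap R S (ψ y 3) * (x 3 - algebraMap R S (B 3)) := fun y => by
    rw [← Fin.sum_univ_four fun j => algebraMap R S (ψ y j) * (x j - algebraMap R S (B j)),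
      ← shiftedForm_apply]
    exact hl.lift_eq _ y
  refine ⟨AlgEquiv.ofAlgHom f g (hl.algHom_ext (LinearMap.ext fun y => ?_)) ?_⟩
  · have hy := congrArg (algebraMap R Y) (h₂' y)
    have hay := sum_algebraMap_mul_apply_single l ξ (ψ y)
    rw [h₂] at hay
    simp only [map_add, map_mul, map_zero] at hy
    change f (g (l y)) = l y
    simp only [hg, map_add, map_mul, map_sub, AlgHom.commutes, hf]
    simp only [a] at *
    linear_combination hay - q * hy
  · have hr := h.rel
    have hr' := h.rel'
    have hpBS := congrArg (algebraMap R S) hpB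
    have hBS := congrArg (algebraMap R S) hB
    have hpS := congrArg (algebraMap R S) hp
    simp at hpBS hBS hpS hr
    -- `β = b(B, x)` is the coordinate of `x` along `p`; on the quadric it must equal `-q(y)`.
    let β : S := algebraMap R S (B 3) * x 0 - algebraMap R S (B 2) * x 1
      - algebraMap R S (B 1) * x 2 + algebraMap R S (B 0) * x 3
    have hga : ∀ i, g (a i) = x i - algebraMap R S (B i) - algebraMap R S (p i) * β := by
      intro i
      simp only [a, hg, h₃, map_sub, map_mul]
      simp [β]
      linear_combination sum_algebraMap_mul_single (R := R) i x - sum_algebraMap_mul_single (R := R)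
        i (fun j => algebraMap R S (B j)) + algebraMap R S (B i) * (hpBS - hr)
        + 2 * algebraMap R S (p i) * hBS
    have hgq : g q = -β := by
      simp only [q, map_sub, map_mul, hga]
      simp only [β]
      linear_combination hr' + hBS + β ^ 2 * hpS - β * hr + β * hpBS
    refine h.hom_ext _ _ _ fun i => ?_
    have hgai := hga i
    simp only [AlgHom.comp_apply, hf, map_add, map_sub, map_mul, AlgHom.commutes, AlgHom.id_apply,
      hga, hgq]
    ring

end Sym

variable {R : Type u} [CommRing R] (A : Matrix (Fin 2) (Fin 2) R)

/-- A splitting of the inclusion of `modP A`. -/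
def modPProdEquiv (w : Fin 4 → R) (hw : Lam A w = 1) : (modP A × R) ≃ₗ[R] (Fin 4 → R) where
  toFun y := y.1 + y.2 • w
  invFun x := (⟨x - Lam A x • w, by simp [hw]⟩, Lam A x)
  map_add' y z := by simp [add_smul]; abel
  map_smul' r y := by simp [mul_smul]
  left_inv y := by
    have : Lam A y.1 = 0 := y.1.2
    ext <;> simp [hw, this]
  right_inv x := by simp

theorem isProjectiveOfRank_modP (hA : IsUnimodular R A) : IsProjectiveOfRank 3 R (modP A) := by
  obtain ⟨w, hw⟩ := exists_lam_eq_one A hA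
  exact isProjectiveOfRank_of_prod_equiv (modPProdEquiv A w hw) 3 fun _ => by simp

/-- The linear map with matrix `![![0, -1, 0, 0], ![1, 0, 0, 0], ![0, 0, 0, -1], ![0, 0, 1, 0]]`. -/
def symplecticMap (R : Type u) [CommRing R] : (Fin 4 → R) →ₗ[R] (Fin 4 → R) where
  toFun x := ![-x 1, x 0, -x 3, x 2]
  map_add' x y := by ext i; fin_cases i <;> simp <;> ring
  map_smul' r x := by ext i; fin_cases i <;> simp

/-- The linear map `(x, y, z, w) ↦ (w, -z, -y, x)`. -/
def hyperbolicMap (R : Type u) [CommRing R] : (Fin 4 → R) →ₗ[R] (Fin 4 → R) where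
  toFun x := ![x 3, -x 2, -x 1, x 0]
  map_add' x y := by ext i; fin_cases i <;> simp <;> ring
  map_smul' r x := by ext i; fin_cases i <;> simp

/-- The scalar product with `v`. -/
def dotMap (v : Fin 4 → R) : (Fin 4 → R) →ₗ[R] R where
  toFun x := v 0 * x 0 + v 1 * x 1 + v 2 * x 2 + v 3 * x 3
  map_add' x y := by simp; ring
  map_smul' r x := by simp; ring

theorem dotMap_apply (v x : Fin 4 → R) :
    dotMap v x = v 0 * x 0 + v 1 * x 1 + v 2 * x 2 + v 3 * x 3 := rfl

theorem symplecticMap_zero (x : Fin 4 → R) : symplecticMap R x 0 = -x 1 := rfl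
theorem symplecticMap_one (x : Fin 4 → R) : symplecticMap R x 1 = x 0 := rfl
theorem symplecticMap_two (x : Fin 4 → R) : symplecticMap R x 2 = -x 3 := rfl
theorem symplecticMap_three (x : Fin 4 → R) : symplecticMap R x 3 = x 2 := rfl
theorem hyperbolicMap_zero (x : Fin 4 → R) : hyperbolicMap R x 0 = x 3 := rfl
theorem hyperbolicMap_one (x : Fin 4 → R) : hyperbolicMap R x 1 = -x 2 := rfl
theorem hyperbolicMap_two (x : Fin 4 → R) : hyperbolicMap R x 2 = -x 1 := rfl
theorem hyperbolicMap_three (x : Fin 4 → R) : hyperbolicMap R x 3 = x 0 := rfl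

theorem forall_fin_four {p : Fin 4 → Prop} (h₀ : p 0) (h₁ : p 1) (h₂ : p 2) (h₃ : p 3) (i : Fin 4) :
    p i := by
  fin_cases i <;> assumption

theorem dotMap_single (w : Fin 4 → R) (i : Fin 4) : dotMap w (Pi.single i 1) = w i := by
  fin_cases i <;> simp [dotMap_apply]

/-- The translation argument yields `Sym(R⁴/Rv)`, so the point is an isomorphism of `R⁴/Rv` with
`P`, supplied by the symplectic map. -/
theorem nonempty_algU_algEquiv (hA : IsUnimodular R A) :
    Nonempty (AlgU A ≃ₐ[R] SymmetricAlgebra R (modP A)) := by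
  obtain ⟨w, hw⟩ := exists_lam_eq_one A hA
  let v := entries A
  change v 0 * w 0 + v 1 * w 1 + v 2 * w 2 + v 3 * w 3 = 1 at hw
  let J := symplecticMap R
  -- Apply `J`, then remove the component `v · Jx` along `w` and the component `Jw · Jx = w · x`
  -- along `Jv`, and put the first one back as the coefficient of `Jv`. The image lies in `ker v`,
  -- and `v` is killed because `Jv` is.
  let ξ' : (Fin 4 → R) →ₗ[R] (Fin 4 → R) := J
    - (dotMap v ∘ₗ J).smulRight w + (dotMap v ∘ₗ J - dotMap w).smulRight (J v)
  have hξ' : ∀ x j, ξ' x j = J x j - dotMap v (J x) * w j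
    + (dotMap v (J x) - dotMap w x) * J v j := fun _ _ => rfl
  let ξ : (Fin 4 → R) →ₗ[R] modP A := LinearMap.codRestrict _ ξ' fun x => by
    change dotMap v (ξ' x) = 0
    simp only [dotMap_apply, hξ', J, symplecticMap_zero, symplecticMap_one, symplecticMap_two,
      symplecticMap_three]
    linear_combination (v 0 * x 1 - v 1 * x 0 + v 2 * x 3 - v 3 * x 2) * hw
  let t : (Fin 4 → R) →ₗ[R] R := dotMap (J w)
  -- The reverse exchange: `t` reads off the coefficient of `Jv`, which is moved back to `w` before
  -- applying `J⁻¹ = -J`.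
  let ψ' : (Fin 4 → R) →ₗ[R] (Fin 4 → R) := - J - t.smulRight v - t.smulRight (J w)
  have hψ' : ∀ y j, ψ' y j = - J y j - t y * v j - t y * J w j := fun _ _ => rfl
  let ψ : modP A →ₗ[R] (Fin 4 → R) := ψ' ∘ₗ (modP A).subtype
  refine (isUniversalU_algU A).nonempty_algEquiv_of_isSymmetricAlgebra
    SymmetricAlgebra.isSymmetricAlgebra_ι w hw ξ ψ ?_ ?_ ?_
  · refine Subtype.ext (funext fun j => ?_)
    change ξ' v j = 0
    rw [hξ']
    have h : dotMap v (J v) = 0 := by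
      simp only [dotMap_apply, J, symplecticMap_zero, symplecticMap_one, symplecticMap_two,
        symplecticMap_three]
      ring
    rw [h, dotMap_apply]
    linear_combination - J v j * hw
  · intro y
    have hy : dotMap v y.1 = 0 := y.2
    refine Subtype.ext (funext fun j => ?_)
    change ξ' (ψ' y.1) j = y.1 j
    have h₁ : dotMap v (J (ψ' y.1)) = t y.1 := by
      simp only [t, dotMap_apply, hψ', J, symplecticMap_zero, symplecticMap_one, symplecticMap_two,
        symplecticMap_three] at hy ⊢
      linear_combination hy + (-w 1 * y.1 0 + w 0 * y.1 1 - w 3 * y.1 2 + w 2 * y.1 3) * hw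
    have h₂ : dotMap w (ψ' y.1) = 0 := by
      simp only [t, dotMap_apply, hψ', J, symplecticMap_zero, symplecticMap_one, symplecticMap_two,
        symplecticMap_three] at hy ⊢
      linear_combination - (-w 1 * y.1 0 + w 0 * y.1 1 - w 3 * y.1 2 + w 2 * y.1 3) * hw
    have h₃ : ∀ j, J (ψ' y.1) j = y.1 j - t y.1 * J v j + t y.1 * w j := by
      refine forall_fin_four ?_ ?_ ?_ ?_ <;>
      simp only [hψ', J, symplecticMap_zero, symplecticMap_one, symplecticMap_two,
        symplecticMap_three] <;> ring
    rw [hξ', h₁, h₂, h₃]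
    ring
  · intro i j
    have hw' : dotMap w (Pi.single i 1) = w i := dotMap_single w i
    change ψ' (ξ' _) j = _
    rw [← hw']
    generalize (Pi.single i 1 : Fin 4 → R) = x
    have h₁ : t (ξ' x) = dotMap v (J x) := by
      simp only [t, dotMap_apply, hξ', J, symplecticMap_zero, symplecticMap_one, symplecticMap_two,
        symplecticMap_three]
      linear_combination (v 1 * x 0 - v 0 * x 1 + v 3 * x 2 - v 2 * x 3
        - (w 0 * x 0 + w 1 * x 1 + w 2 * x 2 + w 3 * x 3)) * hw
    have h₂ : ∀ j, J (ξ' x) j = - x j - dotMap v (J x) * J w j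
        - (dotMap v (J x) - dotMap w x) * v j := by
      refine forall_fin_four ?_ ?_ ?_ ?_ <;>
      simp only [hξ', J, symplecticMap_zero, symplecticMap_one, symplecticMap_two,
        symplecticMap_three] <;> ring
    rw [hψ', h₁, h₂]
    ring

/-- A singular matrix with unimodular entries has an isotropic vector `B` with `Λ_A B = 1`. -/
theorem exists_isotropic_lam_eq_one (hA : IsUnimodular R A) (hdet : A.det = 0) :
    ∃ B : Fin 4 → R, dotMap (entries A) B = 1 ∧ B 0 * B 3 = B 1 * B 2 := by
  obtain ⟨w, hw⟩ := exists_lam_eq_one A hA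
  let v := entries A
  have hdet' : v 0 * v 3 - v 1 * v 2 = 0 := (Matrix.det_fin_two A).symm.trans hdet
  change v 0 * w 0 + v 1 * w 1 + v 2 * w 2 + v 3 * w 3 = 1 at hw
  -- The witness is `w - q(w) Hv`. As `Hv` is isotropic and `b(Hv, w) = v · w = 1`, subtracting this
  -- multiple cancels `q(w)` and keeps the product with `v`.
  let q := w 0 * w 3 - w 1 * w 2
  refine ⟨![w 0 - q * v 3, w 1 + q * v 2, w 2 + q * v 1, w 3 - q * v 0], ?_, ?_⟩
  · change v 0 * (w 0 - q * v 3) + v 1 * (w 1 + q * v 2) + v 2 * (w 2 + q * v 1)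
      + v 3 * (w 3 - q * v 0) = 1
    linear_combination hw - 2 * q * hdet'
  · change (w 0 - q * v 3) * (w 3 - q * v 0) = (w 1 + q * v 2) * (w 2 + q * v 1)
    linear_combination - q * hw + q ^ 2 * hdet'

/-! ### Splitting off a hyperbolic plane. -/

section Isotropic

variable (v B : Fin 4 → R)

/-- The orthogonal complement of the hyperbolic plane that is spanned by `hyperbolicMap R v` and
`B`. -/
abbrev orthogonal : Submodule R (Fin 4 → R) :=
  LinearMap.ker (dotMap v) ⊓ LinearMap.ker (dotMap (hyperbolicMap R B))

theorem hyperbolicMap_hyperbolicMap (x : Fin 4 → R) :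
    hyperbolicMap R (hyperbolicMap R x) = x := by
  refine funext (forall_fin_four rfl ?_ ?_ rfl) <;> exact neg_neg _

theorem dotMap_hyperbolicMap (x y : Fin 4 → R) :
    dotMap x (hyperbolicMap R y) = dotMap (hyperbolicMap R x) y := by
  simp only [dotMap_apply, hyperbolicMap_zero, hyperbolicMap_one, hyperbolicMap_two,
    hyperbolicMap_three]
  ring

theorem dotMap_comm (x y : Fin 4 → R) : dotMap x y = dotMap y x := by
  simp only [dotMap_apply]
  ring

theorem dotMap_hyperbolicMap_hyperbolicMap (v B : Fin 4 → R) :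
    dotMap (hyperbolicMap R B) (hyperbolicMap R v) = dotMap v B := by
  rw [dotMap_hyperbolicMap, hyperbolicMap_hyperbolicMap, dotMap_comm]

theorem dotMap_hyperbolicMap_self {v : Fin 4 → R} (hv : v 0 * v 3 = v 1 * v 2) :
    dotMap v (hyperbolicMap R v) = 0 := by
  simp only [dotMap_apply, hyperbolicMap_zero, hyperbolicMap_one, hyperbolicMap_two,
    hyperbolicMap_three]
  linear_combination 2 * hv

variable {v B} (hv : v 0 * v 3 = v 1 * v 2) (hB : B 0 * B 3 = B 1 * B 2) (hvB : dotMap v B = 1)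

include hv hB hvB

theorem orthogonalProjection_mem (x : Fin 4 → R) :
    x - dotMap (hyperbolicMap R B) x • hyperbolicMap R v - dotMap v x • B ∈ orthogonal v B := by
  have h₁ : dotMap v (hyperbolicMap R v) = 0 := by
    simp only [dotMap_apply, hyperbolicMap_zero, hyperbolicMap_one, hyperbolicMap_two,
      hyperbolicMap_three]
    linear_combination 2 * hv
  have h₂ : dotMap (hyperbolicMap R B) B = 0 := by
    simp only [dotMap_apply, hyperbolicMap_zero, hyperbolicMap_one, hyperbolicMap_two,
      hyperbolicMap_three]
    linear_combination 2 * hB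
  have h₃ := dotMap_hyperbolicMap_hyperbolicMap v B
  rw [hvB] at h₃
  refine ⟨?_, ?_⟩
  · change dotMap v _ = 0
    simp [h₁, hvB]
  · change dotMap (hyperbolicMap R B) _ = 0
    simp [h₂, h₃]

/-- The projection onto the orthogonal complement. -/
def orthogonalProjection : (Fin 4 → R) →ₗ[R] orthogonal v B :=
  LinearMap.codRestrict _ (LinearMap.id
    - (dotMap (hyperbolicMap R B)).smulRight (hyperbolicMap R v) - (dotMap v).smulRight B)
    (orthogonalProjection_mem hv hB hvB)

theorem orthogonalProjection_apply (x : Fin 4 → R) (j : Fin 4) :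
    (orthogonalProjection hv hB hvB x).1 j =
      x j - dotMap (hyperbolicMap R B) x * hyperbolicMap R v j - dotMap v x * B j := rfl

theorem orthogonalProjection_hyperbolicMap :
    orthogonalProjection hv hB hvB (hyperbolicMap R v) = 0 := by
  refine Subtype.ext (funext fun j => ?_)
  rw [orthogonalProjection_apply, dotMap_hyperbolicMap_hyperbolicMap, hvB,
    dotMap_hyperbolicMap_self hv]
  simp

theorem orthogonalProjection_self : orthogonalProjection hv hB hvB B = 0 := by
  refine Subtype.ext (funext fun j => ?_)
  rw [orthogonalProjection_apply, hvB, dotMap_comm, dotMap_hyperbolicMap_self hB]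
  simp

theorem orthogonalProjection_coe (y : orthogonal v B) :
    orthogonalProjection hv hB hvB y.1 = y := by
  have h₁ : dotMap v y.1 = 0 := y.2.1
  have h₂ : dotMap (hyperbolicMap R B) y.1 = 0 := y.2.2
  refine Subtype.ext (funext fun j => ?_)
  rw [orthogonalProjection_apply, h₁, h₂]
  ring

/-- The projection changes `x` only by elements of the hyperbolic plane, to which `y` is orthogonal.
-/
theorem dotMap_hyperbolicMap_orthogonalProjection (x : Fin 4 → R) (y : orthogonal v B) :
    dotMap (hyperbolicMap R y.1) (orthogonalProjection hv hB hvB x).1 =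
      dotMap (hyperbolicMap R y.1) x := by
  have h₁ : dotMap v y.1 = 0 := y.2.1
  have h₂ : dotMap (hyperbolicMap R B) y.1 = 0 := y.2.2
  simp only [dotMap_apply, orthogonalProjection_apply, hyperbolicMap_zero, hyperbolicMap_one,
    hyperbolicMap_two, hyperbolicMap_three] at h₁ h₂ ⊢
  linear_combination (-B 3 * x 0 + B 2 * x 1 + B 1 * x 2 - B 0 * x 3) * h₁
    - (v 0 * x 0 + v 1 * x 1 + v 2 * x 2 + v 3 * x 3) * h₂

/-- The linear form `y ↦ b(y, ·)` on the orthogonal complement. -/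
def orthogonalForm (v B : Fin 4 → R) : orthogonal v B →ₗ[R] Module.Dual R (orthogonal v B) :=
  LinearMap.mk₂ R (fun y z => dotMap (hyperbolicMap R y.1) z.1)
    (fun y y' z => by
      simp [dotMap_apply, hyperbolicMap_zero, hyperbolicMap_one, hyperbolicMap_two,
        hyperbolicMap_three]
      ring)
    (fun r y z => by
      simp [dotMap_apply, hyperbolicMap_zero, hyperbolicMap_one, hyperbolicMap_two,
        hyperbolicMap_three]
      ring)
    (fun y z z' => by simp) (fun r y z => by simp)

/-- The form is perfect on `R⁴`, and perfectness passes to an orthogonal summand: functionals extend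
along the projection, and representing vectors are projected back. -/
theorem orthogonalForm_bijective : Function.Bijective (orthogonalForm v B) := by
  refine ⟨(injective_iff_map_eq_zero _).2 fun y hy => ?_, fun l => ?_⟩
  · have h : ∀ x, dotMap (hyperbolicMap R y.1) x = 0 := fun x => by
      rw [← dotMap_hyperbolicMap_orthogonalProjection hv hB hvB]
      exact LinearMap.congr_fun hy _
    have h' : ∀ i, hyperbolicMap R y.1 i = 0 := fun i => by
      rw [← dotMap_single (hyperbolicMap R y.1) i, h]
    refine Subtype.ext (funext (forall_fin_four ?_ ?_ ?_ ?_))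
    · exact h' 3
    · exact neg_eq_zero.1 (h' 2)
    · exact neg_eq_zero.1 (h' 1)
    · exact h' 0
  · let π := orthogonalProjection hv hB hvB
    let u : Fin 4 → R := fun i => l (π (Pi.single i 1))
    refine ⟨π (hyperbolicMap R u), LinearMap.ext fun z => ?_⟩
    have h : l z = dotMap u z.1 := by
      conv_lhs => rw [← orthogonalProjection_coe hv hB hvB z]
      have := sum_algebraMap_mul_apply_single l π z.1
      rw [← this, dotMap_apply]
      simp only [u, Algebra.algebraMap_self, RingHom.id_apply]
      ring
    rw [h]
    have h₁ := dotMap_hyperbolicMap_orthogonalProjection hv hB hvB (hyperbolicMap R u) z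
    refine Eq.trans (b := dotMap (hyperbolicMap R z.1) (π (hyperbolicMap R u)).1) ?_ (h₁.trans ?_)
    · change dotMap (hyperbolicMap R _) _ = _
      simp only [dotMap_apply, hyperbolicMap_zero, hyperbolicMap_one,
        hyperbolicMap_two, hyperbolicMap_three]
      ring
    · simp only [dotMap_apply, hyperbolicMap_zero, hyperbolicMap_one,
        hyperbolicMap_two, hyperbolicMap_three]
      ring

/-- The orthogonal complement of `hyperbolicMap R v` is the sum of `orthogonal v B` and the line
spanned by `hyperbolicMap R v`. -/
def orthogonalProdEquiv : (orthogonal v B × R) ≃ₗ[R] LinearMap.ker (dotMap v) where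
  toFun y := ⟨y.1.1 + y.2 • hyperbolicMap R v, by
    have h₁ : dotMap v y.1.1 = 0 := y.1.2.1
    rw [LinearMap.mem_ker, map_add, map_smul, h₁]
    simp only [dotMap_apply, hyperbolicMap_zero, hyperbolicMap_one, hyperbolicMap_two,
      hyperbolicMap_three, smul_eq_mul]
    -- `hyperbolicMap R v` is isotropic, hence lies in its own orthogonal complement `ker v`.
    linear_combination 2 * y.2 * hv⟩
  invFun x := (orthogonalProjection hv hB hvB x.1, dotMap (hyperbolicMap R B) x.1)
  map_add' y z := by
    refine Subtype.ext ?_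
    simp [add_smul]
    abel
  map_smul' r y := by
    refine Subtype.ext ?_
    simp [mul_smul]
  left_inv y := by
    have h₁ : dotMap v y.1.1 = 0 := y.1.2.1
    have h₂ : dotMap (hyperbolicMap R B) y.1.1 = 0 := y.1.2.2
    have h₃ := dotMap_hyperbolicMap_hyperbolicMap v B
    rw [hvB] at h₃
    have h₄ := orthogonalProjection_hyperbolicMap hv hB hvB
    refine Prod.ext ?_ ?_
    · simp [h₄, orthogonalProjection_coe]
    · simp [h₂, h₃]
  right_inv x := by
    have h₁ : dotMap v x.1 = 0 := x.2
    refine Subtype.ext (funext fun j => ?_)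
    change (orthogonalProjection hv hB hvB x.1).1 j + dotMap (hyperbolicMap R B) x.1 *
      hyperbolicMap R v j = x.1 j
    rw [orthogonalProjection_apply, h₁]
    ring

/-- Self-duality enters through `H`: it carries the linear functions, the quotient of `R⁴` by `v`
and `H B`, onto the complement itself. -/
theorem nonempty_algD_algEquiv_symmetricAlgebra {S : Type u} [CommRing S] [Algebra R S]
    {x : Fin 4 → S} (h : IsUniversalD v S x) :
    Nonempty (S ≃ₐ[R] SymmetricAlgebra R (orthogonal v B)) := by
  let π := orthogonalProjection hv hB hvB
  let H := hyperbolicMap R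
  refine h.nonempty_algEquiv_of_isSymmetricAlgebra SymmetricAlgebra.isSymmetricAlgebra_ι
    (hyperbolicMap R v) B ?_ hB ?_ hvB (π ∘ₗ H) (H ∘ₗ (orthogonal v B).subtype) ?_ ?_ ?_ ?_ ?_
  · exact (hyperbolicMap_hyperbolicMap v).symm
  · change v 3 * v 0 = -v 2 * -v 1
    linear_combination hv
  · exact orthogonalProjection_hyperbolicMap hv hB hvB
  · change π (H (H B)) = 0
    rw [hyperbolicMap_hyperbolicMap, orthogonalProjection_self]
  · intro y
    change π (H (H y.1)) = y
    rw [hyperbolicMap_hyperbolicMap, orthogonalProjection_coe]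
  · intro y
    change dotMap (H y.1) (H v) = 0
    rw [dotMap_hyperbolicMap_hyperbolicMap]
    exact y.2.1
  · intro i j
    have h₁ : dotMap (H B) (H (Pi.single i 1)) = B i := by
      rw [dotMap_hyperbolicMap_hyperbolicMap, dotMap_comm, dotMap_single]
    have h₂ : dotMap v (H (Pi.single i 1)) = H v i := by
      rw [dotMap_hyperbolicMap, dotMap_single]
    change H (π (H _)).1 j = (Pi.single i 1 : Fin 4 → R) j - B i * v j - H v i * H B j
    have h₃ : (π (H (Pi.single i 1))).1 = H (Pi.single i 1) - B i • H v - H v i • B := by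
      rw [← h₁, ← h₂]
      rfl
    rw [h₃]
    simp [H, hyperbolicMap_hyperbolicMap]

end Isotropic

theorem exists_selfDual_of_det_eq_zero (hA : IsUnimodular R A) (hdet : A.det = 0) :
    ∃ (Q : Type u) (_ : AddCommGroup Q) (_ : Module R Q),
        IsProjectiveOfRank 2 R Q ∧
        Nonempty (Q ≃ₗ[R] Module.Dual R Q) ∧
        Nonempty (AlgD A ≃ₐ[R] SymmetricAlgebra R Q) ∧
        Nonempty ((Q × R) ≃ₗ[R] modP A) ∧
        Nonempty ((Q × R × R) ≃ₗ[R] (Fin 4 → R)) := by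
  obtain ⟨B, hAB, hB⟩ := exists_isotropic_lam_eq_one A hA hdet
  have hA' : entries A 0 * entries A 3 = entries A 1 * entries A 2 :=
    sub_eq_zero.1 ((Matrix.det_fin_two A).symm.trans hdet)
  let e : (orthogonal (entries A) B × R) ≃ₗ[R] modP A := orthogonalProdEquiv hA' hB hAB
  let e' : (orthogonal (entries A) B × R × R) ≃ₗ[R] (Fin 4 → R) :=
    (LinearEquiv.prodAssoc R _ R R).symm ≪≫ₗ (e.prodCongr (LinearEquiv.refl R R)) ≪≫ₗ
      modPProdEquiv A B hAB
  exact ⟨orthogonal (entries A) B, inferInstance, inferInstance,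
    isProjectiveOfRank_of_prod_equiv e' 2 fun _ => by simp,
    ⟨LinearEquiv.ofBijective _ (orthogonalForm_bijective hA' hB hAB)⟩,
    nonempty_algD_algEquiv_symmetricAlgebra hA' hB hAB (isUniversalD_algD A), ⟨e⟩, ⟨e'⟩⟩

end MatrixExt

/-! ### Morphisms to affine schemes and the action of `𝔾_m`. -/

noncomputable section

namespace MatrixExt

open LaurentPolynomial (T C)

/-- The ring homomorphism `S → Γ(Y, ⊤)` that corresponds to a morphism `Y ⟶ Spec S`. -/
def pullbackFun {S : Type u} [CommRing S] {Y : Scheme.{u}} (f : Y ⟶ Spec (CommRingCat.of S)) :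
    S →+* Γ(Y, ⊤) :=
  ((Scheme.ΓSpecIso (CommRingCat.of S)).inv ≫ f.appTop).hom

/-- Only the target has to be affine. This reduces the diagrams of schemes below to identities
between global functions. -/
theorem pullbackFun_injective {S : Type u} [CommRing S] {Y : Scheme.{u}} :
    Function.Injective (pullbackFun (S := S) (Y := Y)) := fun f g h => by
  refine ext_of_isAffine ?_
  rw [← cancel_epi (Scheme.ΓSpecIso (CommRingCat.of S)).inv]
  exact CommRingCat.hom_ext h

theorem pullbackFun_comp_specMap {S S' : Type u} [CommRing S] [CommRing S'] {Y : Scheme.{u}}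
    (f : Y ⟶ Spec (CommRingCat.of S')) (φ : S →+* S') (s : S) :
    pullbackFun (f ≫ Spec.map (CommRingCat.ofHom φ)) s = pullbackFun f (φ s) := by
  have h := Scheme.ΓSpecIso_inv_naturality (CommRingCat.ofHom φ)
  simp only [pullbackFun]
  rw [Scheme.Hom.comp_appTop, ← Category.assoc, ← h, Category.assoc]
  rfl

section

variable {R H S : Type u} [CommRing R] [CommRing H] [CommRing S] [Algebra R H] [Algebra R S]

theorem pullbackFun_comp_pullbackSpecIso {Y : Scheme.{u}}
    (k : Y ⟶ pullback (specMap R H) (specMap R S)) (h : H) (s : S) :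
    pullbackFun (k ≫ (pullbackSpecIso R H S).hom) (h ⊗ₜ[R] s) =
      pullbackFun (k ≫ pullback.fst _ _) h * pullbackFun (k ≫ pullback.snd _ _) s := by
  have h₁ : (h ⊗ₜ[R] s : H ⊗[R] S) = (h ⊗ₜ 1) * (1 ⊗ₜ s) := by simp
  rw [h₁, map_mul, ← pullbackSpecIso_hom_fst, ← pullbackSpecIso_hom_snd, ← Category.assoc,
    ← Category.assoc, pullbackFun_comp_specMap, pullbackFun_comp_specMap]
  rfl

theorem pullbackFun_comp_specCoaction {Y : Scheme.{u}}
    (k : Y ⟶ pullback (specMap R H) (specMap R S)) (χ : S →ₐ[R] H ⊗[R] S) {s s' : S} {h : H}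
    (hs : χ s = h ⊗ₜ s') :
    pullbackFun (k ≫ specCoaction χ) s =
      pullbackFun (k ≫ pullback.fst _ _) h * pullbackFun (k ≫ pullback.snd _ _) s' := by
  rw [specCoaction, ← Category.assoc, pullbackFun_comp_specMap]
  have : χ.toRingHom s = h ⊗ₜ s' := hs
  rw [this, pullbackFun_comp_pullbackSpecIso]

end

variable {R S : Type u} [CommRing R] [CommRing S] [Algebra R S]

/-- The functions of a morphism to an affine scheme. -/
abbrev overFun {Y : Over (Spec (CommRingCat.of R))} (f : Y ⟶ SpecOver R S) : S →+* Γ(Y.left, ⊤) :=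
  pullbackFun f.left

theorem overFun_algebraMap {Y : Over (Spec (CommRingCat.of R))} (f : Y ⟶ SpecOver R S) (r : R) :
    overFun f (algebraMap R S r) = pullbackFun Y.hom r := by
  refine (pullbackFun_comp_specMap f.left (algebraMap R S) r).symm.trans ?_
  congr 2
  exact Over.w f

theorem overHom_ext {Y : Over (Spec (CommRingCat.of R))} {f g : Y ⟶ SpecOver R S}
    (h : overFun f = overFun g) : f = g :=
  Over.OverMorphism.ext (pullbackFun_injective h)

theorem overFun_comp_actionOfCoaction {Y : Over (Spec (CommRingCat.of R))}
    (χ : S →ₐ[R] R[T;T⁻¹] ⊗[R] S) (k : Y ⟶ Gm R ⊗ SpecOver R S) {s s' : S} {h : R[T;T⁻¹]}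
    (hs : χ s = h ⊗ₜ s') :
    overFun (k ≫ actionOfCoaction χ) s =
      overFun (k ≫ CartesianMonoidalCategory.fst _ _) h *
        overFun (k ≫ CartesianMonoidalCategory.snd _ _) s' :=
  pullbackFun_comp_specCoaction k.left χ hs

/-- `T n` is group-like, and multiplication on `Gm R` is the morphism attached to the
comultiplication. -/
theorem overFun_comp_mul {Y : Over (Spec (CommRingCat.of R))} (k : Y ⟶ Gm R ⊗ Gm R) (n : ℤ) :
    overFun (k ≫ μ[Gm R]) (T n : R[T;T⁻¹]) =
      overFun (k ≫ CartesianMonoidalCategory.fst _ _) (T n : R[T;T⁻¹]) *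
        overFun (k ≫ CartesianMonoidalCategory.snd _ _) (T n : R[T;T⁻¹]) :=
  pullbackFun_comp_specCoaction k.left (Bialgebra.comulAlgHom R R[T;T⁻¹]) (by simp)

theorem overFun_comp_one {Y : Over (Spec (CommRingCat.of R))} (k : Y ⟶ 𝟙_ _) (n : ℤ) :
    overFun (k ≫ η[Gm R]) (T n : R[T;T⁻¹]) = 1 := by
  refine (pullbackFun_comp_specMap k.left (Bialgebra.counitAlgHom R R[T;T⁻¹]).toRingHom _).trans ?_
  have : (Bialgebra.counitAlgHom R R[T;T⁻¹]).toRingHom (T n) = 1 := by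
    change Bialgebra.counitAlgHom R R[T;T⁻¹] (T n) = 1
    simp
  rw [this, map_one]

/-- A coaction of `R[T;T⁻¹]` that is diagonal on a set of generators defines an action. -/
theorem isGmAction_actionOfCoaction {I : Type*} (χ : S →ₐ[R] R[T;T⁻¹] ⊗[R] S) (x : I → S)
    (n : I → ℤ) (hχ : ∀ i, χ (x i) = T (n i) ⊗ₜ x i)
    (hx : ∀ (B : Type u) [CommRing B] (f g : S →+* B),
      (∀ r, f (algebraMap R S r) = g (algebraMap R S r)) → (∀ i, f (x i) = g (x i)) → f = g) :
    IsGmAction (actionOfCoaction χ) := by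
  have hext : ∀ {Y : Over (Spec (CommRingCat.of R))} {f g : Y ⟶ SpecOver R S},
      (∀ i, overFun f (x i) = overFun g (x i)) → f = g := fun {Y f g} h =>
    overHom_ext (hx _ _ _ (fun r => by rw [overFun_algebraMap, overFun_algebraMap]) h)
  -- On the coordinate `x i` the axioms read `1 * x i = x i` and `(g h)^(n i) * x i = g^(n i) *
  -- (h^(n i) * x i)`.
  refine ⟨{ smul := actionOfCoaction χ, one_smul := ?_, mul_smul := ?_ }, rfl⟩
  · change η[Gm R] ▷ SpecOver R S ≫ actionOfCoaction χ = (λ_ _).hom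
    refine hext fun i => ?_
    rw [overFun_comp_actionOfCoaction χ _ (hχ i), CartesianMonoidalCategory.whiskerRight_fst,
      CartesianMonoidalCategory.whiskerRight_snd, overFun_comp_one, one_mul,
      CartesianMonoidalCategory.leftUnitor_hom]
  · change μ[Gm R] ▷ SpecOver R S ≫ actionOfCoaction χ =
      (α_ _ _ _).hom ≫ (Gm R ◁ actionOfCoaction χ) ≫ actionOfCoaction χ
    refine hext fun i => ?_
    rw [overFun_comp_actionOfCoaction χ _ (hχ i), CartesianMonoidalCategory.whiskerRight_fst,
      CartesianMonoidalCategory.whiskerRight_snd, overFun_comp_mul, ← Category.assoc,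
      overFun_comp_actionOfCoaction χ _ (hχ i), Category.assoc, Category.assoc,
      CartesianMonoidalCategory.whiskerLeft_fst, CartesianMonoidalCategory.whiskerLeft_snd,
      ← Category.assoc _ _ (actionOfCoaction χ), overFun_comp_actionOfCoaction χ _ (hχ i)]
    simp [mul_assoc]

theorem isGmAction_chi (A : Matrix (Fin 2) (Fin 2) R) : IsGmAction (actionOfCoaction (chi A)) := by
  refine isGmAction_actionOfCoaction (chi A) (xX A) ![1, 1, -1, -1] (fun i => ?_)
    fun B _ f g hC hX => QuotAlg.hom_ext _ (fun r => ?_) hX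
  · refine (chiR_xX A i).trans ?_
    fin_cases i <;> rfl
  · rw [IsScalarTower.algebraMap_apply R (AlgD A) (AlgX A), hC]

end MatrixExt

end

/-! ### Local trivializations of the torsor. -/

noncomputable section

namespace MatrixExt

open LaurentPolynomial (T C)

theorem laurentPolynomial_ringHom_ext {R B : Type*} [CommRing R] [CommRing B] {f g : R[T;T⁻¹] →+* B}
    (hC : ∀ r, f (C r) = g (C r)) (hT : f (T 1) = g (T 1)) : f = g := by
  have hX : algebraMap (Polynomial R) R[T;T⁻¹] Polynomial.X = T 1 := by
    simp [LaurentPolynomial.algebraMap_eq_toLaurent]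
  refine IsLocalization.ringHom_ext (Submonoid.powers (Polynomial.X : Polynomial R))
    (Polynomial.ringHom_ext (fun r => ?_) ?_)
  · simpa [LaurentPolynomial.algebraMap_eq_toLaurent] using hC r
  · simpa [LaurentPolynomial.algebraMap_eq_toLaurent] using hT

theorem overHom_gm_ext {R : Type u} [CommRing R] {Y : Over (Spec (CommRingCat.of R))}
    {f g : Y ⟶ Gm R} (h : overFun f (T 1 : R[T;T⁻¹]) = overFun g (T 1 : R[T;T⁻¹])) : f = g :=
  overHom_ext (laurentPolynomial_ringHom_ext
    (fun r => (overFun_algebraMap f r).trans (overFun_algebraMap g r).symm) h)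

section

variable {R R' S : Type u} [CommRing R] [CommRing R'] [CommRing S] [Algebra R R'] [Algebra R S]

/-- A trivialization of the base change of `Spec S` to `R'`. -/
def baseChangeIsoGm (θ : R'[T;T⁻¹] ≃+* S ⊗[R] R') (hC : ∀ r, θ (C r) = 1 ⊗ₜ r) :
    baseChange R' (SpecOver R S) ≅ Gm R' :=
  Over.isoMk (pullbackSpecIso R S R' ≪≫ Scheme.Spec.mapIso θ.toCommRingCatIso.op) (by
    change ((pullbackSpecIso R S R').hom ≫ Spec.map (CommRingCat.ofHom θ.toRingHom)) ≫
      Spec.map (CommRingCat.ofHom (algebraMap R' R'[T;T⁻¹])) = pullback.snd _ _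
    rw [Category.assoc, ← Spec.map_comp, ← CommRingCat.ofHom_comp, ← pullbackSpecIso_hom_snd]
    congr 3
    ext r
    exact hC r)

/-- The projection from the base change. -/
def baseChangeFst (R R' S : Type u) [CommRing R] [CommRing R'] [CommRing S] [Algebra R R']
    [Algebra R S] : (baseChange R' (SpecOver R S)).left ⟶ Spec (CommRingCat.of S) :=
  pullback.fst (specMap R S) (specMap R R')

theorem overFun_comp_baseChangeIsoGm (θ : R'[T;T⁻¹] ≃+* S ⊗[R] R')
    (hC : ∀ r, θ (C r) = 1 ⊗ₜ r) {s : S} (hT : θ (T 1) = s ⊗ₜ 1)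
    {Y : Over (Spec (CommRingCat.of R'))} (k : Y ⟶ baseChange R' (SpecOver R S)) :
    overFun (k ≫ (baseChangeIsoGm θ hC).hom) (T 1 : R'[T;T⁻¹]) =
      pullbackFun (k.left ≫ baseChangeFst R R' S) s := by
  let k' : Y.left ⟶ pullback (specMap R S) (specMap R R') := k.left
  have h : θ.toRingHom (T 1) = s ⊗ₜ 1 := hT
  have h' : pullbackFun (k' ≫ (pullbackSpecIso R S R').hom ≫
      Spec.map (CommRingCat.ofHom θ.toRingHom)) (T 1 : R'[T;T⁻¹]) =
      pullbackFun (k' ≫ pullback.fst _ _) s := by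
    rw [← Category.assoc, pullbackFun_comp_specMap, h, pullbackFun_comp_pullbackSpecIso, map_one,
      mul_one]
  exact h'

/-- A morphism to `𝔾_m` is determined by the pullback of `T`. The trivialization sends `T` to `s`,
which has weight 1, so both composites pull `T` back to the product of `T` and `s`. -/
theorem actBaseChange_comp_baseChangeIsoGm (χ : S →ₐ[R] R[T;T⁻¹] ⊗[R] S)
    (θ : R'[T;T⁻¹] ≃+* S ⊗[R] R') (hC : ∀ r, θ (C r) = 1 ⊗ₜ r) {s : S} (hT : θ (T 1) = s ⊗ₜ 1)
    (hs : χ s = T 1 ⊗ₜ s) :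
    actBaseChange R' (actionOfCoaction χ) ≫ (baseChangeIsoGm θ hC).hom =
      (Gm R' ◁ (baseChangeIsoGm θ hC).hom) ≫ μ[Gm R'] := by
  refine overHom_gm_ext ?_
  rw [overFun_comp_baseChangeIsoGm θ hC hT, overFun_comp_mul,
    CartesianMonoidalCategory.whiskerLeft_fst, CartesianMonoidalCategory.whiskerLeft_snd,
    overFun_comp_baseChangeIsoGm θ hC hT]
  have h₁ : (actBaseChange R' (actionOfCoaction χ)).left ≫ baseChangeFst R R' S =
      actProj R' (SpecOver R S) ≫ specCoaction χ := pullback.lift_fst _ _ _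
  have h₂ : actProj R' (SpecOver R S) ≫ pullback.fst (specMap R R[T;T⁻¹]) (specMap R S) =
      pullback.fst (Gm R').hom (baseChange R' (SpecOver R S)).hom ≫ gmMap R' :=
    pullback.lift_fst _ _ _
  have h₃ : actProj R' (SpecOver R S) ≫ pullback.snd (specMap R R[T;T⁻¹]) (specMap R S) =
      pullback.snd (Gm R').hom (baseChange R' (SpecOver R S)).hom ≫
        baseChangeFst R R' S :=
    pullback.lift_snd _ _ _
  have h₄ : (AddMonoidAlgebra.mapRingHom ℤ (algebraMap R R')) (T 1 : R[T;T⁻¹]) = T 1 := by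
    simp only [LaurentPolynomial.T, AddMonoidAlgebra.mapRingHom_single, map_one]
  refine (congrArg (pullbackFun · s) h₁).trans
    ((pullbackFun_comp_specCoaction (actProj R' (SpecOver R S)) χ hs).trans ?_)
  refine congrArg₂ (· * ·) ((congrArg (pullbackFun · (T 1 : R[T;T⁻¹])) h₂).trans ?_)
    (congrArg (pullbackFun · s) h₃)
  refine (pullbackFun_comp_specMap _ _ _).trans ?_
  rw [h₄]
  rfl

end

section

variable {D S : Type u} [CommRing D] [CommRing S] [Algebra D S]

/-- `S` is the universal `D`-algebra in which the `2 × 2` matrix `N` over `D` factors as a column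
`s` times a row `t`. -/
structure IsUniversalFactorization (N : Fin 2 → Fin 2 → D) (s t : Fin 2 → S) : Prop where
  mul_eq (i j : Fin 2) : s i * t j = algebraMap D S (N i j)
  exists_lift {B : Type u} [CommRing B] (φ : D →+* B) (σ τ : Fin 2 → B)
    (h : ∀ i j, σ i * τ j = φ (N i j)) :
    ∃ f : S →+* B, (∀ r, f (algebraMap D S r) = φ r) ∧ (∀ i, f (s i) = σ i) ∧ ∀ j, f (t j) = τ j
  ringHom_ext {B : Type u} [CommRing B] {f g : S →+* B}
    (hD : ∀ r, f (algebraMap D S r) = g (algebraMap D S r)) (hs : ∀ i, f (s i) = g (s i))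
    (ht : ∀ j, f (t j) = g (t j)) : f = g

/-- Once `N p q = s p * t q` is invertible, `s p` is a unit and fixes the rest of the factorization:
`t j = N p j / s p` and `s i = (N i q / N p q) * s p`. Conversely, any unit gives a factorization,
because `N` has vanishing determinant. -/
theorem IsUniversalFactorization.exists_laurent_ringEquiv {N : Fin 2 → Fin 2 → D} {s t : Fin 2 → S}
    (h : IsUniversalFactorization N s t) (hN : N 0 0 * N 1 1 = N 0 1 * N 1 0) (p q : Fin 2)
    (D' : Type u) [CommRing D'] [Algebra D D'] [IsLocalization.Away (N p q) D'] :
    ∃ θ : D'[T;T⁻¹] ≃+* S ⊗[D] D', (∀ r, θ (C r) = 1 ⊗ₜ r) ∧ θ (T 1) = s p ⊗ₜ 1 := by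
  set g : D' := IsLocalization.Away.invSelf (N p q) with hg
  have hgN : algebraMap D D' (N p q) * g = 1 := IsLocalization.Away.mul_invSelf _
  have hrank : ∀ i j, N i j * N p q = N i q * N p j := by
    intro i j
    fin_cases i <;> fin_cases j <;> fin_cases p <;> fin_cases q <;>
      simp <;> first | ring1 | linear_combination hN | linear_combination -hN
  have hmap : ∀ r : D, (1 ⊗ₜ algebraMap D D' r : S ⊗[D] D') = algebraMap D S r ⊗ₜ 1 := fun r => by
    rw [Algebra.algebraMap_eq_smul_one, Algebra.algebraMap_eq_smul_one, TensorProduct.smul_tmul]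
  have hcoef : ∀ i j, (s i ⊗ₜ 1 * t j ⊗ₜ g : S ⊗[D] D') = 1 ⊗ₜ (algebraMap D D' (N i j) * g) :=
    fun i j => by
      rw [Algebra.TensorProduct.tmul_mul_tmul, h.mul_eq, one_mul,
        ← mul_one (algebraMap D S (N i j)), ← one_mul g, ← Algebra.TensorProduct.tmul_mul_tmul,
        ← hmap, Algebra.TensorProduct.tmul_mul_tmul, one_mul, one_mul]
  have hu : (s p ⊗ₜ 1 * t q ⊗ₜ g : S ⊗[D] D') = 1 := by
    rw [hcoef, hgN, Algebra.TensorProduct.one_def]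
  let σ : (S ⊗[D] D')ˣ := ⟨s p ⊗ₜ 1, t q ⊗ₜ g, hu, (mul_comm _ _).trans hu⟩
  let fwd : D'[T;T⁻¹] →+* S ⊗[D] D' := LaurentPolynomial.eval₂
    (Algebra.TensorProduct.includeRight : D' →ₐ[D] S ⊗[D] D').toRingHom σ
  have fwdC : ∀ r, fwd (C r) = 1 ⊗ₜ r := fun r => LaurentPolynomial.eval₂_C _ _ _
  have fwdT : ∀ n, fwd (T n) = (σ ^ n : (S ⊗[D] D')ˣ) := fun n => LaurentPolynomial.eval₂_T _ _ _
  -- These are the forced values of the column and the row when `s p` is set to `T`; `hrank` makes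
  -- their product `N`.
  obtain ⟨b₀, hbD, hbs, hbt⟩ := h.exists_lift ((algebraMap D' D'[T;T⁻¹]).comp (algebraMap D D'))
    (fun i => C (algebraMap D D' (N i q) * g) * T 1)
    (fun j => C (algebraMap D D' (N p j)) * T (-1)) (fun i j => by
      have h₁ : algebraMap D D' (N i j) = algebraMap D D' (N i q) * g * algebraMap D D' (N p j) := by
        have := congrArg (algebraMap D D') (hrank i j)
        rw [map_mul, map_mul] at this
        linear_combination -algebraMap D D' (N i j) * hgN + g * this
      have h₂ : (T 1 * T (-1) : D'[T;T⁻¹]) = 1 := by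
        rw [← LaurentPolynomial.T_add]; simp
      change _ = C (algebraMap D D' (N i j))
      rw [h₁, map_mul C (algebraMap D D' (N i q) * g)]
      linear_combination C (algebraMap D D' (N i q) * g) * C (algebraMap D D' (N p j)) * h₂)
  let b : S →ₐ[D] D'[T;T⁻¹] := { b₀ with commutes' := hbD }
  let bwd : S ⊗[D] D' →ₐ[D] D'[T;T⁻¹] :=
    Algebra.TensorProduct.lift b (IsScalarTower.toAlgHom D D' D'[T;T⁻¹]) fun _ _ => Commute.all _ _
  have bwd_s : ∀ x, bwd (x ⊗ₜ 1) = b₀ x := fun x => by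
    simp [bwd, b]
  have bwd_D : ∀ r, bwd (1 ⊗ₜ r) = C r := fun r => by
    simp [bwd, b]
  have hb : ∀ x, fwd (b₀ x) = x ⊗ₜ 1 := by
    have : fwd.comp b₀ =
        (Algebra.TensorProduct.includeLeft : S →ₐ[D] S ⊗[D] D').toRingHom := by
      refine h.ringHom_ext (fun r => ?_) (fun i => ?_) fun j => ?_
      · change fwd (b₀ _) = algebraMap D S r ⊗ₜ 1
        rw [hbD, ← hmap]
        exact fwdC _
      · change fwd (b₀ _) = s i ⊗ₜ 1
        rw [hbs, map_mul, fwdC, fwdT, zpow_one, ← hcoef]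
        linear_combination (s i ⊗ₜ 1 : S ⊗[D] D') * hu
      · change fwd (b₀ _) = t j ⊗ₜ 1
        have hst : ((s p * t j) ⊗ₜ 1 : S ⊗[D] D') = s p ⊗ₜ 1 * t j ⊗ₜ 1 := by simp
        rw [hbt, map_mul, fwdC, fwdT, zpow_neg_one, hmap, ← h.mul_eq, hst]
        change _ * t q ⊗ₜ g = _
        linear_combination (t j ⊗ₜ 1 : S ⊗[D] D') * hu
    exact fun x => RingHom.congr_fun this x
  refine ⟨RingEquiv.ofRingHom fwd bwd.toRingHom (RingHom.ext fun x => ?_)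
    (laurentPolynomial_ringHom_ext (fun r => ?_) ?_), fwdC, (fwdT 1).trans (by simp [σ])⟩
  · change fwd (bwd x) = x
    induction x with
    | zero => simp
    | add x y hx hy => rw [map_add, map_add, hx, hy]
    | tmul x y =>
      rw [show (x ⊗ₜ y : S ⊗[D] D') = (x ⊗ₜ 1) * (1 ⊗ₜ y) by simp, map_mul, map_mul, bwd_s, bwd_D,
        hb, fwdC]
  · change bwd (fwd (C r)) = C r
    rw [fwdC, bwd_D]
  · change bwd (fwd (T 1)) = T 1
    rw [fwdT, zpow_one]
    change bwd (s p ⊗ₜ 1) = T 1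
    rw [bwd_s, hbs, hgN, map_one, one_mul]

end

end MatrixExt

end

/-! ### The torsor and the smoothness of `ρ`. -/

noncomputable section

namespace MatrixExt

open LaurentPolynomial (T C)

theorem isStandardSmoothOfRelativeDimension_mvPolynomial (n : ℕ) (R : Type u) [CommRing R] :
    Algebra.IsStandardSmoothOfRelativeDimension n R (MvPolynomial (Fin n) R) := by
  let v : Fin 0 → MvPolynomial (Fin n) R := Fin.elim0
  have : IsLocalization.Away (1 : QuotAlg (Set.range v)) (QuotAlg (Set.range v)) :=
    IsLocalization.away_of_isUnit_of_bijective _ isUnit_one Function.bijective_id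
  have h : Algebra.IsStandardSmoothOfRelativeDimension n R (QuotAlg (Set.range v)) :=
    isStandardSmoothOfRelativeDimension_of_isUnit_jacobian (add_zero n) v Fin.elim0
      (fun i => i.elim0) _ 1 (by simp)
  have hv : Ideal.span (Set.range v) = ⊥ := by simp
  let e : QuotAlg (Set.range v) ≃ₐ[R] MvPolynomial (Fin n) R :=
    (Ideal.quotientEquivAlgOfEq R hv).trans (AlgEquiv.quotientBot R _)
  exact .of_algEquiv n e

theorem isStandardSmoothOfRelativeDimension_laurentPolynomial (R : Type u) [CommRing R] :
    Algebra.IsStandardSmoothOfRelativeDimension 1 R R[T;T⁻¹] := by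
  have := isStandardSmoothOfRelativeDimension_mvPolynomial 1 R
  have : Algebra.IsStandardSmoothOfRelativeDimension 1 R (Polynomial R) :=
    .of_algEquiv 1 (MvPolynomial.uniqueAlgEquiv R (Fin 1))
  have : Algebra.IsStandardSmoothOfRelativeDimension 0 (Polynomial R) R[T;T⁻¹] :=
    .localization_away (Polynomial.X : Polynomial R)
  have : IsScalarTower R (Polynomial R) R[T;T⁻¹] := .of_algebraMap_eq fun r => by
    simp [LaurentPolynomial.algebraMap_eq_toLaurent]
  exact .trans 1 0 R (Polynomial R) R[T;T⁻¹]

variable {D S : Type u} [CommRing D] [CommRing S] [Algebra D S]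

/-- Smoothness is local on the source, and over `D' = D_{N p q}` the map is the localization `D →
D'` followed by `D' → D'[T;T⁻¹]`, of relative dimensions 0 and 1. -/
theorem IsUniversalFactorization.smoothOfRelativeDimension {N : Fin 2 → Fin 2 → D}
    {s t : Fin 2 → S} (h : IsUniversalFactorization N s t) (hN : N 0 0 * N 1 1 = N 0 1 * N 1 0)
    (htop : Ideal.span (Set.range fun p : Fin 2 × Fin 2 => N p.1 p.2) = ⊤) :
    IsSmoothOfRelDim 1 D S := by
  rw [IsSmoothOfRelDim, HasRingHomProperty.Spec_iff (P := @SmoothOfRelativeDimension 1)]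
  refine RingHom.locally_of_exists RingHom.isStandardSmoothOfRelativeDimension_respectsIso _
    (fun p : Fin 2 × Fin 2 => algebraMap D S (N p.1 p.2)) ?_
    (fun p => S ⊗[D] Localization.Away (N p.1 p.2)) fun p => ?_
  · have := congrArg (Ideal.map (algebraMap D S)) htop
    rw [Ideal.map_span, Ideal.map_top, ← Set.range_comp] at this
    exact this
  · let D' := Localization.Away (N p.1 p.2)
    obtain ⟨θ, hC, -⟩ := h.exists_laurent_ringEquiv hN p.1 p.2 D'
    have h₁ : RingHom.IsStandardSmoothOfRelativeDimension 0 (algebraMap D D') :=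
      (RingHom.isStandardSmoothOfRelativeDimension_algebraMap 0).2
        (.localization_away (N p.1 p.2))
    have h₂ : RingHom.IsStandardSmoothOfRelativeDimension 1 (algebraMap D' D'[T;T⁻¹]) :=
      (RingHom.isStandardSmoothOfRelativeDimension_algebraMap 1).2
        (isStandardSmoothOfRelativeDimension_laurentPolynomial D')
    have h₃ := (RingHom.IsStandardSmoothOfRelativeDimension.equiv θ).comp (h₂.comp h₁)
    rw [add_zero, zero_add] at h₃
    refine (RingHom.ext fun r => ?_ : (algebraMap S (S ⊗[D] D')).comp (algebraMap D S) =
      (θ : D'[T;T⁻¹] →+* S ⊗[D] D').comp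
        ((algebraMap D' D'[T;T⁻¹]).comp (algebraMap D D'))) ▸ h₃
    have hr : θ (C (algebraMap D D' r)) = 1 ⊗ₜ algebraMap D D' r := hC _
    refine Eq.trans ?_ hr.symm
    change algebraMap D S r ⊗ₜ 1 = _
    rw [Algebra.algebraMap_eq_smul_one, Algebra.algebraMap_eq_smul_one, TensorProduct.smul_tmul]

/-- The spectrum of the universal factorization is a torsor if the entries of the matrix generate
the unit ideal. -/
theorem IsUniversalFactorization.isGmTorsor {N : Fin 2 → Fin 2 → D} {s t : Fin 2 → S}
    (h : IsUniversalFactorization N s t) (hN : N 0 0 * N 1 1 = N 0 1 * N 1 0)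
    {χ : S →ₐ[D] D[T;T⁻¹] ⊗[D] S} (hs : ∀ i, χ (s i) = T 1 ⊗ₜ s i)
    (hχ : IsGmAction (actionOfCoaction χ)) {m : ℕ} (f : Fin (m + 1) → D)
    (hf : IsUnimodular D f) (hfN : ∀ k, ∃ p q, f k = N p q) :
    IsGmTorsor (actionOfCoaction χ) := by
  refine ⟨hχ, m, f, hf, fun k => ?_⟩
  obtain ⟨p, q, hk⟩ := hfN k
  rw [hk]
  obtain ⟨θ, hC, hT⟩ := h.exists_laurent_ringEquiv hN p q (Localization.Away (N p q))
  exact ⟨baseChangeIsoGm θ hC, actBaseChange_comp_baseChangeIsoGm χ θ hC hT (hs p)⟩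

variable {R : Type u} [CommRing R] (A : Matrix (Fin 2) (Fin 2) R)

/-- The matrix of the variables of `𝓓`. -/
def matD : Fin 2 → Fin 2 → AlgD A := ![![xD A 0, xD A 1], ![xD A 2, xD A 3]]

/-- The row is `(W, Z)`, in this order, since `ρ` sends `X, Y, Z, W` to `XW, XZ, YW, YZ`.
Substituting these products turns the linear relation of `𝓓` into the defining relation of `𝓧`, so a
factorization over a `𝓓`-algebra is all that is needed to map out of `𝓧`. -/
theorem isUniversalFactorization_algX :
    IsUniversalFactorization (matD A) ![xX A 0, xX A 1] ![xX A 3, xX A 2] where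
  mul_eq i j := by
    fin_cases i <;> fin_cases j
    exacts [(algebraMap_xD A 0).symm, (algebraMap_xD A 1).symm, (algebraMap_xD A 2).symm,
      (algebraMap_xD A 3).symm]
  exists_lift {B} _ φ σ τ hστ := by
    let : Algebra R B := (φ.comp (algebraMap R (AlgD A))).toAlgebra
    have hR : ∀ r, algebraMap R B r = φ (algebraMap R (AlgD A) r) := fun _ => rfl
    have h₀₀ := hστ 0 0
    have h₀₁ := hστ 0 1
    have h₁₀ := hστ 1 0
    have h₁₁ := hστ 1 1
    simp only [matD, Matrix.cons_val_zero, Matrix.cons_val_one] at h₀₀ h₀₁ h₁₀ h₁₁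
    have hrel := congrArg φ (isUniversalD_algD A).rel
    simp only [map_add, map_mul, map_one, ← hR, ← h₀₀, ← h₀₁, ← h₁₀, ← h₁₁] at hrel
    let f : AlgX A →ₐ[R] B := QuotAlg.lift _ ![σ 0, σ 1, τ 1, τ 0] (by
      rintro p rfl
      simp [entries] at hrel
      simp [polyX]
      linear_combination -hrel)
    have hf : ∀ i, f (xX A i) = ![σ 0, σ 1, τ 1, τ 0] i := fun i => MvPolynomial.aeval_X _ i
    refine ⟨f, fun r => ?_, fun i => ?_, fun j => ?_⟩
    · refine RingHom.congr_fun (f := f.toRingHom.comp (algebraMap (AlgD A) (AlgX A))) (g := φ)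
        (QuotAlg.hom_ext _ (fun r => ?_) fun i => ?_) r
      · change f (algebraMap _ _ (algebraMap _ _ r)) = _
        rw [← IsScalarTower.algebraMap_apply, AlgHom.commutes, hR]
      · change f (algebraMap _ _ (xD A i)) = φ (xD A i)
        rw [algebraMap_xD]
        fin_cases i
        · exact (map_mul f _ _).trans ((congrArg₂ (· * ·) (hf 0) (hf 3)).trans h₀₀)
        · exact (map_mul f _ _).trans ((congrArg₂ (· * ·) (hf 0) (hf 2)).trans h₀₁)
        · exact (map_mul f _ _).trans ((congrArg₂ (· * ·) (hf 1) (hf 3)).trans h₁₀)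
        · exact (map_mul f _ _).trans ((congrArg₂ (· * ·) (hf 1) (hf 2)).trans h₁₁)
    · fin_cases i
      · exact hf 0
      · exact hf 1
    · fin_cases j
      · exact hf 3
      · exact hf 2
  ringHom_ext {B} _ f g hD hs ht := by
    refine QuotAlg.hom_ext _ (fun r => ?_) fun i => ?_
    · rw [IsScalarTower.algebraMap_apply R (AlgD A) (AlgX A), hD]
    · fin_cases i
      · exact hs 0
      · exact hs 1
      · exact ht 1
      · exact ht 0

/-- The linear relation of `𝓓` is itself the certificate; no hypothesis on `A` is involved. -/
theorem isUnimodular_xD : IsUnimodular (AlgD A) (xD A) := by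
  refine ⟨∑ i, algebraMap R (AlgD A) (entries A i) • LinearMap.proj i, ?_⟩
  simpa [Fin.sum_univ_four, Algebra.smul_def] using (isUniversalD_algD A).rel

theorem matD_rel : matD A 0 0 * matD A 1 1 = matD A 0 1 * matD A 1 0 :=
  (isUniversalD_algD A).rel'

theorem exists_xD_eq_matD (k : Fin 4) : ∃ p q, xD A k = matD A p q := by
  fin_cases k
  exacts [⟨0, 0, rfl⟩, ⟨0, 1, rfl⟩, ⟨1, 0, rfl⟩, ⟨1, 1, rfl⟩]

theorem isGmTorsor_chi : IsGmTorsor (actionOfCoaction (chi A)) :=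
  (isUniversalFactorization_algX A).isGmTorsor (matD_rel A)
    (fun i => by
      fin_cases i
      · exact chiR_xX A 0
      · exact chiR_xX A 1)
    (isGmAction_chi A) (xD A) (isUnimodular_xD A) (exists_xD_eq_matD A)

theorem smoothOfRelativeDimension_rho :
    SmoothOfRelativeDimension 1 (Spec.map (CommRingCat.ofHom (rho A).toRingHom)) := by
  refine (isUniversalFactorization_algX A).smoothOfRelativeDimension (matD_rel A)
    ((Ideal.eq_top_iff_one _).2 ?_)
  rw [← (isUniversalD_algD A).rel]
  have hmem : ∀ k, xD A k ∈ Ideal.span (Set.range fun p : Fin 2 × Fin 2 => matD A p.1 p.2) :=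
    fun k => by
      obtain ⟨p, q, hk⟩ := exists_xD_eq_matD A k
      exact Ideal.subset_span ⟨(p, q), hk.symm⟩
  exact add_mem (add_mem (add_mem (Ideal.mul_mem_left _ _ (hmem 0))
    (Ideal.mul_mem_left _ _ (hmem 1))) (Ideal.mul_mem_left _ _ (hmem 2)))
    (Ideal.mul_mem_left _ _ (hmem 3))

end MatrixExt

end

theorem theorem6 {R : Type u} [CommRing R] (A : Matrix (Fin 2) (Fin 2) R)
    (hA : IsUnimodular R A) :
    ((∀ i j : Fin 2, Nonempty (LocAway (A i j) (AlgU A) ≃ₐ[Localization.Away (A i j)]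
        MvPolynomial (Fin 3) (Localization.Away (A i j)))) ∧
      IsSmoothOfRelDim 3 R (AlgU A)) ∧
    (IsProjectiveOfRank 3 R (modP A) ∧
      Nonempty (AlgU A ≃ₐ[R] SymmetricAlgebra R (modP A))) ∧
    IsSmoothOfRelDim 2 R (AlgD A) ∧
    IsSmoothOfRelDim 4 R (AlgE A) ∧
    (IsSmoothOfRelDim 3 R (Localization.Away (elemW A)) ∧
      (IsNilpotent (A 0 0 * A 1 1 - A 0 1 * A 1 0) → IsSmoothOfRelDim 3 R (AlgW A))) ∧
    IsGmAction (actionOfCoaction (chi A)) ∧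
    (IsGmTorsor (actionOfCoaction (chi A)) ∧
      SmoothOfRelativeDimension 1 (Spec.map (CommRingCat.ofHom (rho A).toRingHom)) ∧
      IsSmoothOfRelDim 3 R (AlgX A)) ∧
    (A.det = 0 →
      (∀ i j : Fin 2, Nonempty (LocAway (A i j) (AlgD A) ≃ₐ[Localization.Away (A i j)]
        MvPolynomial (Fin 2) (Localization.Away (A i j)))) ∧
      ∃ (Q : Type u) (_ : AddCommGroup Q) (_ : Module R Q),
        IsProjectiveOfRank 2 R Q ∧
        Nonempty (Q ≃ₗ[R] Module.Dual R Q) ∧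
        Nonempty (AlgD A ≃ₐ[R] SymmetricAlgebra R Q) ∧
        Nonempty ((Q × R) ≃ₗ[R] modP A) ∧
        Nonempty ((Q × R × R) ≃ₗ[R] (Fin 4 → R))) := by
  exact ⟨⟨nonempty_locAway_algU_algEquiv A, isSmoothOfRelDim_algU A hA⟩,
    ⟨isProjectiveOfRank_modP A hA, nonempty_algU_algEquiv A hA⟩,
    isSmoothOfRelDim_algD A, isSmoothOfRelDim_algE A,
    ⟨isSmoothOfRelDim_away_algW A (Localization.Away (elemW A)), isSmoothOfRelDim_algW A⟩,
    isGmAction_chi A,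
    ⟨isGmTorsor_chi A, smoothOfRelativeDimension_rho A, isSmoothOfRelDim_algX A⟩,
    fun hdet => ⟨nonempty_locAway_algD_algEquiv A hdet, exists_selfDual_of_det_eq_zero A hA hdet⟩⟩
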